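/- Let $M$ be a flat Klein bottle, i.e. a closed nonorientable flat surface, presented as a quotient $M=\mathbb R^2/\Gamma$, where $\Gamma$ is a group of isometries of the Euclidean plane that acts freely and properly discontinuously with compact quotient and contains an orientation-reversing isometry; $M$ carries the induced flat Riemannian metric $g$, distance and area. Then $L^2(M)$ has an orthonormal basis $e_0,e_1,e_2,\dots$ of smooth (complex-valued) Laplace–Beltrami eigenfunctions, $\Delta_g e_j=-\lambda_j^2e_j$ with $\lambda_j\ge 0$. For every such basis, let $$N_x(\lambda)=\sum_{\lambda_j\le\lambda}|e_j(x)|^2\qquad(x\in M,\ \lambda\in\mathbb R)$$ be the pointwise Weyl counting function. Then: 1. $N_x$ is not constant in $x$: there are $\lambda\in\mathbb R$ and $x,y\in M$ with $N_x(\lambda)\neq N_y(\lambda)$. 2. Echolocation holds on $M$: if $x,y\in M$ satisfy $N_x(\lambda)=N_y(\lambda)$ for all $\lambda\in\mathbb R$, then there is an isometry $F:M\to M$ with $F(x)=y$. -/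

import Mathlib

open MeasureTheory InnerProductSpace
open scoped ENNReal ContDiff Laplacian

noncomputable section

/-- The Euclidean plane. -/
abbrev Plane : Type := EuclideanSpace ℝ (Fin 2)

/-- The group of all Euclidean isometries of the plane. -/
abbrev PlaneIsometry : Type := Plane ≃ᵃⁱ[ℝ] Plane

/-- The isometry group acts on the plane by evaluation. -/
instance planeIsometryMulAction : MulAction PlaneIsometry Plane where
  smul γ p := γ p
  one_smul _ := rfl
  mul_smul _ _ _ := rfl

theorem planeIsometry_smul_def (γ : PlaneIsometry) (p : Plane) : γ • p = γ p := rfl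

/-- An isometry of the plane reverses orientation if its linear part has negative determinant. -/
def PlaneIsometry.ReversesOrientation (γ : PlaneIsometry) : Prop :=
  LinearMap.det (γ.linearIsometryEquiv.toLinearEquiv : Plane →ₗ[ℝ] Plane) < 0

/-- A flat Klein bottle, that is, a closed nonorientable flat surface, presented as the quotient
of the Euclidean plane by its deck group: a group of Euclidean isometries that acts freely and
properly discontinuously with compact quotient and that contains an orientation-reversing
isometry. -/
structure FlatKleinBottle where
  /-- The deck group. -/
  Γ : Subgroup PlaneIsometry
  free : ∀ γ ∈ Γ, ∀ p : Plane, γ p = p → γ = 1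
  properlyDiscontinuous : ProperlyDiscontinuousSMul Γ Plane
  compact : CompactSpace (MulAction.orbitRel.Quotient Γ Plane)
  nonorientable : ∃ γ ∈ Γ, PlaneIsometry.ReversesOrientation γ

namespace FlatKleinBottle

/-- The points of the flat Klein bottle `M = ℝ² / Γ`: the orbits of `Γ`. -/
def Carrier (M : FlatKleinBottle) : Type := MulAction.orbitRel.Quotient M.Γ Plane

/-- The universal covering map `ℝ² → M`. It is the local isometry that defines the flat metric. -/
def proj (M : FlatKleinBottle) (p : Plane) : M.Carrier :=
  Quotient.mk (MulAction.orbitRel M.Γ Plane) p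

theorem proj_surjective (M : FlatKleinBottle) : Function.Surjective M.proj :=
  Quotient.mk_surjective

theorem proj_eq_iff (M : FlatKleinBottle) {p q : Plane} :
    M.proj p = M.proj q ↔ ∃ γ ∈ M.Γ, γ q = p := by
  refine (Quotient.eq (r := MulAction.orbitRel M.Γ Plane)).trans ?_
  rw [MulAction.orbitRel_apply]
  constructor
  · rintro ⟨⟨γ, hγ⟩, h⟩
    exact ⟨γ, hγ, h⟩
  · rintro ⟨γ, hγ, h⟩
    exact ⟨⟨γ, hγ⟩, h⟩

/-- The Riemannian distance on `M`: the distance between the two fibres in the plane. -/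
instance instDist (M : FlatKleinBottle) : Dist M.Carrier where
  dist x y := sInf (Set.image2 dist (M.proj ⁻¹' {x}) (M.proj ⁻¹' {y}))

theorem dist_def (M : FlatKleinBottle) (x y : M.Carrier) :
    dist x y = sInf (Set.image2 dist (M.proj ⁻¹' {x}) (M.proj ⁻¹' {y})) := rfl

theorem bddBelow_image2_dist (S T : Set Plane) : BddBelow (Set.image2 dist S T) := by
  refine ⟨0, ?_⟩
  rintro _ ⟨p, -, q, -, rfl⟩
  exact dist_nonneg

theorem dist_proj_le (M : FlatKleinBottle) (p q : Plane) :
    dist (M.proj p) (M.proj q) ≤ dist p q :=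
  csInf_le (bddBelow_image2_dist _ _) ⟨p, rfl, q, rfl, rfl⟩

theorem exists_dist_lt (M : FlatKleinBottle) (p : Plane) (y : M.Carrier) {r : ℝ}
    (h : dist (M.proj p) y < r) : ∃ q, M.proj q = y ∧ dist p q < r := by
  obtain ⟨z, rfl⟩ := M.proj_surjective y
  have hne : (Set.image2 dist (M.proj ⁻¹' {M.proj p}) (M.proj ⁻¹' {M.proj z})).Nonempty :=
    ⟨_, p, rfl, z, rfl, rfl⟩
  obtain ⟨_, ⟨p', hp', q', hq', rfl⟩, hlt⟩ := exists_lt_of_csInf_lt hne h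
  obtain ⟨γ, hγ, rfl⟩ := M.proj_eq_iff.1 (Eq.symm hp')
  refine ⟨γ q', ?_, by rwa [γ.dist_map]⟩
  rw [← show M.proj q' = M.proj z from hq']
  exact M.proj_eq_iff.2 ⟨γ, hγ, rfl⟩

instance instMetricSpace (M : FlatKleinBottle) : MetricSpace M.Carrier where
  dist_self x := by
    obtain ⟨p, rfl⟩ := M.proj_surjective x
    refine le_antisymm ((M.dist_proj_le p p).trans_eq (dist_self p)) ?_
    exact Real.sInf_nonneg (by rintro _ ⟨p, -, q, -, rfl⟩; exact dist_nonneg)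
  dist_comm x y := by
    rw [dist_def, dist_def, Set.image2_swap]
    simp_rw [dist_comm]
  dist_triangle x y z := by
    refine le_of_forall_pos_lt_add fun ε hε => ?_
    obtain ⟨p, rfl⟩ := M.proj_surjective x
    obtain ⟨q, rfl, hq⟩ := M.exists_dist_lt p y (lt_add_of_pos_right _ (half_pos hε))
    obtain ⟨r, rfl, hr⟩ := M.exists_dist_lt q z (lt_add_of_pos_right _ (half_pos hε))
    have h1 := M.dist_proj_le p r
    have h2 := dist_triangle p q r
    linarith
  eq_of_dist_eq_zero := by
    intro x y h
    obtain ⟨p, rfl⟩ := M.proj_surjective x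
    obtain ⟨q, rfl⟩ := M.proj_surjective y
    have hfin : (M.proj ⁻¹' {M.proj q} ∩ Metric.closedBall p 1).Finite := by
      have := M.properlyDiscontinuous.finite_disjoint_inter_image
        (isCompact_singleton (x := q)) (isCompact_closedBall p 1)
      refine (this.image (fun γ : M.Γ => γ • q)).subset ?_
      rintro z ⟨hz, hzb⟩
      obtain ⟨γ, hγ, rfl⟩ := M.proj_eq_iff.1 hz
      exact ⟨⟨γ, hγ⟩, ⟨γ q, ⟨q, rfl, rfl⟩, hzb⟩, rfl⟩
    have hcl : p ∈ closure (M.proj ⁻¹' {M.proj q} ∩ Metric.closedBall p 1) := by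
      rw [Metric.mem_closure_iff]
      intro ε hε
      obtain ⟨z, hz, hlt⟩ := M.exists_dist_lt p (M.proj q) (r := min ε 1)
        (by rw [h]; exact lt_min hε one_pos)
      refine ⟨z, ⟨hz, ?_⟩, hlt.trans_le (min_le_left _ _)⟩
      rw [Metric.mem_closedBall, dist_comm]
      exact (hlt.trans_le (min_le_right _ _)).le
    rw [hfin.isClosed.closure_eq] at hcl
    exact hcl.1

instance instMeasurableSpace (M : FlatKleinBottle) : MeasurableSpace M.Carrier := borel _

instance instBorelSpace (M : FlatKleinBottle) : BorelSpace M.Carrier := ⟨rfl⟩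

/-- The Riemannian area measure of `M`: the two-dimensional Hausdorff measure of its distance,
normalized so that it is Lebesgue measure for the Euclidean plane. -/
def area (M : FlatKleinBottle) : Measure M.Carrier := μHE[2]

/-- `f` is a smooth function on `M` with `Δ_g f = -λ² f`. As `M.proj` is a local isometry and a
smooth covering, both conditions are read off on the plane, where `Δ` is the usual Laplacian. -/
structure IsEigenfunction (M : FlatKleinBottle) (f : M.Carrier → ℂ) (lam : ℝ) : Prop where
  smooth : ContDiff ℝ ∞ (f ∘ M.proj)
  laplacian_eq : ∀ p : Plane, Δ (f ∘ M.proj) p = -((lam : ℂ) ^ 2) * f (M.proj p)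

/-- An orthonormal basis `e₀, e₁, …` of `L²(M)` of Laplace–Beltrami eigenfunctions with
`Δ_g e_j = -λ_j² e_j` and `λ_j ≥ 0`. -/
structure Eigenbasis (M : FlatKleinBottle) where
  /-- The orthonormal basis of `L²(M)`. -/
  basis : HilbertBasis ℕ ℂ (Lp ℂ 2 M.area)
  /-- The eigenfunctions, as functions on `M`. -/
  e : ℕ → M.Carrier → ℂ
  /-- The frequencies `λ_j`. -/
  freq : ℕ → ℝ
  ae_eq : ∀ j, (basis j : M.Carrier → ℂ) =ᵐ[M.area] e j
  isEigenfunction : ∀ j, M.IsEigenfunction (e j) (freq j)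
  freq_nonneg : ∀ j, 0 ≤ freq j

/-- The pointwise Weyl counting function `N_x(λ) = ∑_{λ_j ≤ λ} |e_j(x)|²`, as a sum of nonnegative
terms in `[0, ∞]`. -/
def weylCount {M : FlatKleinBottle} (B : M.Eigenbasis) (x : M.Carrier) (lam : ℝ) : ℝ≥0∞ :=
  ∑' j : {j : ℕ // B.freq j ≤ lam}, ‖B.e j x‖ₑ ^ 2

end FlatKleinBottle

end

noncomputable section

/-! In a suitable complex coordinate the deck group is generated by the glide reflection `(x, y) ↦
(x + a, -y)` and the translation `(x, y) ↦ (x, y + b)` (`nonempty_frame`). The functions `e^{πimx/a}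
cos (2πny/b)` for even `m` and `e^{πimx/a} sin (2πny/b)` for odd `m` are invariant under both
generators. After normalization, and with redundant indices removed, they form an orthonormal
eigenbasis of `L²(M)`: completeness is Stone–Weierstrass, orthogonality an explicit integral
(`waveBasis`).

`N_x(λ)` is the diagonal value at `x` of the kernel of the spectral projection to frequencies at
most `λ`, so every eigenbasis gives the same value. Green's identity (`integral_mul_eigenfunction`)
makes eigenfunctions of different frequencies orthogonal. Only finitely many waves have frequency at
most `λ`, so Parseval turns the sum over any eigenbasis into a finite sum over waves
(`weylCount_eq`).

The single value `λ = 2π/b` decides everything. A sine wave has `n ≥ 1` and `m ≠ 0`, hence frequency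
above `2π/b`. The only wave up to this frequency whose modulus depends on the point is therefore
`cos (2πy/b)`, and `N_x(2π/b) = C + (2/(ab)) cos² (2πy/b)` (`exists_weylCount_chart`). This is not
constant. It determines `cos (4πy/b)`, that is, `y` up to sign and modulo `b/2`.

Exactly this ambiguity is absorbed by symmetry. Horizontal translations and the vertical shift by
`b/2` descend to isometries of `M` (`exists_isometry_chart`), while the sign of `y` changes under
the glide reflection, which does not move the point of `M`. -/

/-- A subgroup of the reals that has finitely many elements in `(0, 1)` is cyclic. -/
theorem AddSubgroup.exists_pos_forall_mem_iff {H : AddSubgroup ℝ}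
    (hfin : ((H : Set ℝ) ∩ Set.Ioo 0 1).Finite) (hne : ∃ u ∈ H, u ≠ 0) :
    ∃ a : ℝ, 0 < a ∧ ∀ u, u ∈ H ↔ ∃ k : ℤ, u = k * a := by
  -- The interval is open at `0`, so the finite, hence closed, intersection misses a neighbourhood
  -- of `0`. Thus `0` is isolated among the nonnegative elements, which forces the subgroup to be
  -- cyclic.
  have h0 : (0 : ℝ) ∉ (H : Set ℝ) ∩ Set.Ioo 0 1 := fun h => lt_irrefl _ h.2.1
  obtain ⟨ε, hε, hball⟩ := Metric.mem_nhds_iff.1 (hfin.isClosed.isOpen_compl.mem_nhds h0)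
  have hd : Disjoint (H : Set ℝ) (Set.Ioo 0 (min ε 1)) := by
    rw [Set.disjoint_left]
    intro u hu hu'
    refine hball (a := u) ?_ ⟨hu, hu'.1, hu'.2.trans_le (min_le_right _ _)⟩
    rw [Metric.mem_ball, Real.dist_eq, sub_zero, abs_of_pos hu'.1]
    exact hu'.2.trans_le (min_le_left _ _)
  obtain ⟨c, hc⟩ := AddSubgroup.cyclic_of_isolated_zero (lt_min hε one_pos) hd
  have hmem : ∀ u, u ∈ H ↔ ∃ k : ℤ, u = k * c := by
    intro u
    rw [hc, AddSubgroup.mem_closure_singleton]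
    simp [eq_comm]
  have hc0 : c ≠ 0 := by
    rintro rfl
    obtain ⟨u, hu, hu0⟩ := hne
    obtain ⟨k, hk⟩ := (hmem u).1 hu
    exact hu0 (by simpa using hk)
  refine ⟨|c|, abs_pos.2 hc0, fun u => (hmem u).trans ?_⟩
  rcases abs_choice c with h | h <;> rw [h]
  constructor
  · rintro ⟨k, rfl⟩
    exact ⟨-k, by push_cast; ring⟩
  · rintro ⟨k, rfl⟩
    exact ⟨-k, by push_cast; ring⟩

namespace FlatKleinBottle

variable (M : FlatKleinBottle)

open ComplexConjugate

/-! ### Normal form of the deck group. -/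

/-- Every isometry of the plane has, in a complex coordinate, the form `z ↦ ρ z + w` or
`z ↦ ρ z̄ + w`, and orientation-reversing isometries have the second form. -/
theorem exists_complex_form (J : Plane ≃ₗᵢ[ℝ] ℂ) (γ : PlaneIsometry) :
    (∃ (ρ : Circle) (w : ℂ), ∀ p, J (γ p) = ρ * J p + w) ∧ ¬ γ.ReversesOrientation ∨
    ∃ (ρ : Circle) (w : ℂ), ∀ p, J (γ p) = ρ * conj (J p) + w := by
  have hγ : ∀ p, J (γ p) = J (γ.linearIsometryEquiv p) + J (γ 0) := by
    intro p
    have := γ.map_vadd 0 p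
    simp only [vadd_eq_add, add_zero] at this
    rw [this, map_add]
  obtain ⟨ρ, h | h⟩ := linear_isometry_complex ((J.symm.trans γ.linearIsometryEquiv).trans J)
  · left
    refine ⟨⟨ρ, J (γ 0), fun p => ?_⟩, ?_⟩
    · have := congrArg (fun f : ℂ ≃ₗᵢ[ℝ] ℂ => f (J p)) h
      simp at this
      rw [hγ, this]
    · have hdet := det_rotation ρ
      rw [← h] at hdet
      have := LinearMap.det_conj (γ.linearIsometryEquiv.toLinearEquiv : Plane →ₗ[ℝ] Plane)
        J.toLinearEquiv
      unfold PlaneIsometry.ReversesOrientation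
      rw [← this]
      intro hlt
      refine absurd (hdet.symm.trans_lt (lt_of_eq_of_lt ?_ hlt)) (by norm_num)
      rfl
  · right
    refine ⟨ρ, J (γ 0), fun p => ?_⟩
    have := congrArg (fun f : ℂ ≃ₗᵢ[ℝ] ℂ => f (J p)) h
    simp at this
    rw [hγ, this]

/-- An element of the deck group that acts as `z ↦ ρ z + w` is a translation. -/
theorem rotation_part_eq_one (J : Plane ≃ₗᵢ[ℝ] ℂ) {γ : PlaneIsometry} (hγ : γ ∈ M.Γ) {ρ w : ℂ}
    (h : ∀ p, J (γ p) = ρ * J p + w) : ρ = 1 := by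
  -- A map `z ↦ ρz + w` with `ρ ≠ 1` fixes `w / (1 - ρ)`, which freeness permits only for the
  -- identity.
  by_contra hρ
  have hρ' : 1 - ρ ≠ 0 := sub_ne_zero.2 (Ne.symm hρ)
  have hfix : γ (J.symm (w / (1 - ρ))) = J.symm (w / (1 - ρ)) := by
    apply J.injective
    rw [h, LinearIsometryEquiv.apply_symm_apply]
    field_simp
    ring
  have h1 := M.free γ hγ _ hfix
  subst h1
  have e0 := h (J.symm 0)
  have e1 := h (J.symm 1)
  simp at e0 e1
  rw [← e0] at e1
  exact hρ (by simpa using e1.symm)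

/-- There is a complex coordinate of the plane in which every element of the deck group is a
translation or a reflection in a horizontal line followed by a translation. -/
theorem exists_horizontal_coordinate : ∃ A : Plane ≃ᵃⁱ[ℝ] ℂ,
    (∀ γ ∈ M.Γ, (∃ w, ∀ p, A (γ p) = A p + w) ∨ ∃ w, ∀ p, A (γ p) = conj (A p) + w) ∧
    ∃ γ ∈ M.Γ, ∃ w, ∀ p, A (γ p) = conj (A p) + w := by
  let J : Plane ≃ₗᵢ[ℝ] ℂ := Complex.orthonormalBasisOneI.repr.symm
  obtain ⟨g, hg, hrev⟩ := M.nonorientable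
  obtain ⟨-, hn⟩ | ⟨ρ, w₀, hρ⟩ := exists_complex_form J g
  · exact absurd hrev hn
  -- Multiplying the coordinate by the conjugate of a square root of `ρ` turns `z ↦ ρz̄ + w` into a
  -- reflection in a horizontal line followed by a translation.
  obtain ⟨ζ, hζ⟩ := IsAlgClosed.exists_pow_nat_eq (ρ : ℂ) (n := 2) two_pos
  have hζn : ‖ζ‖ = 1 := by
    have := congrArg norm hζ
    rw [norm_pow, Circle.norm_coe] at this
    exact (pow_eq_one_iff_of_nonneg (norm_nonneg _) two_ne_zero).1 this
  let η : Circle := ⟨ζ, mem_sphere_zero_iff_norm.2 hζn⟩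
  have hη : (η : ℂ) ^ 2 = ρ := hζ
  have hηη : conj (η : ℂ) * η = 1 := by
    rw [← Complex.normSq_eq_conj_mul_self]; simp
  let A : Plane ≃ᵃⁱ[ℝ] ℂ := (J.trans (rotation η⁻¹)).toAffineIsometryEquiv
  have hA : ∀ p, A p = conj (η : ℂ) * J p := by
    intro p
    change rotation η⁻¹ (J p) = _
    rw [rotation_apply, Circle.coe_inv_eq_conj]
  have key : ∀ γ : PlaneIsometry, ∀ w, (∀ p, J (γ p) = ρ * conj (J p) + w) →
      ∃ w, ∀ p, A (γ p) = conj (A p) + w := by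
    intro γ w h
    refine ⟨conj (η : ℂ) * w, fun p => ?_⟩
    rw [hA, hA, h, ← hη, map_mul, Complex.conj_conj]
    linear_combination (η : ℂ) * conj (J p) * hηη
  refine ⟨A, fun γ hγ => ?_, g, hg, key g w₀ hρ⟩
  obtain ⟨⟨ρ', w, h⟩, -⟩ | ⟨ρ', w, h⟩ := exists_complex_form J γ
  · left
    refine ⟨conj (η : ℂ) * w, fun p => ?_⟩
    rw [hA, hA, h, M.rotation_part_eq_one J hγ h]
    ring
  · right
    have hρρ : (ρ : ℂ) * conj (ρ : ℂ) = 1 := by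
      rw [Complex.mul_conj]; simp
    -- The product of two orientation-reversing elements has rotation part `ρ' ρ̄`, which must be
    -- `1`. So all of them share the same `ρ`, and one rotation of the coordinate serves all.
    have h2 : ∀ p, J ((γ * g) p) = (ρ' * conj (ρ : ℂ)) * J p + (ρ' * conj w₀ + w) := by
      intro p
      change J (γ (g p)) = _
      rw [h, hρ, map_add, map_mul, Complex.conj_conj]
      ring
    have h3 := M.rotation_part_eq_one J (M.Γ.mul_mem hγ hg) h2
    have h4 : (ρ' : ℂ) = ρ := by linear_combination (ρ : ℂ) * h3 - ρ' * hρρ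
    rw [h4] at h
    exact key γ w h

/-- Coordinates of the universal cover adapted to the deck group: `M` is the quotient of the plane
by the group generated by the glide reflection `(x, y) ↦ (x + a, -y)` and the translation
`(x, y) ↦ (x, y + b)`. -/
structure Frame where
  /-- The length of the glide. -/
  a : ℝ
  /-- The length of the orthogonal translation. -/
  b : ℝ
  a_pos : 0 < a
  b_pos : 0 < b
  /-- The complex coordinate. -/
  A : Plane ≃ᵃⁱ[ℝ] ℂ
  proj_eq : ∀ p q, M.proj p = M.proj q ↔ ∃ k l : ℤ,
    (A p).re = (A q).re + k * a ∧ (A p).im = (-1) ^ k * (A q).im + l * b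

theorem finite_orbit_inter_closedBall (p : Plane) (r : ℝ) :
    {γ : M.Γ | dist ((γ : PlaneIsometry) p) p ≤ r}.Finite := by
  refine (M.properlyDiscontinuous.finite_disjoint_inter_image
    (isCompact_singleton (x := p)) (isCompact_closedBall p r)).subset ?_
  intro γ hγ
  exact ⟨_, ⟨p, rfl, rfl⟩, hγ⟩

theorem nonempty_frame : Nonempty M.Frame := by
  obtain ⟨A, hform, g, hg, w₀, hgw⟩ := M.exists_horizontal_coordinate
  set o : Plane := A.symm 0 with ho
  have hAo : A o = 0 := A.apply_symm_apply 0
  -- a glide reflection moves points horizontally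
  have hglide : ∀ γ ∈ M.Γ, ∀ w, (∀ p, A (γ p) = conj (A p) + w) → w.re ≠ 0 := by
    -- Without horizontal displacement the map would be a reflection, which fixes its axis `Im z =
    -- w.im / 2` pointwise.
    intro γ hγ w h hw
    have hfix : γ (A.symm ((w.im / 2 : ℝ) * Complex.I)) = A.symm ((w.im / 2 : ℝ) * Complex.I) := by
      apply A.injective
      rw [h, AffineIsometryEquiv.apply_symm_apply]
      apply Complex.ext
      · simp [hw, -Complex.ofReal_div]
      · simp [-Complex.ofReal_div]; ring
    have h1 := M.free γ hγ _ hfix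
    subst h1
    have e0 := h (A.symm 0)
    have e1 := h (A.symm Complex.I)
    simp at e0 e1
    rw [← e0] at e1
    have := congrArg Complex.im e1
    norm_num at this
  -- `U` collects the horizontal displacements of all elements, `V` the vertical translations, and
  -- `H` the horizontal displacements of translations alone. `U` and `V` supply the two lengths; `H`
  -- serves to show that a generator of `U` comes from a glide reflection.
  let U : AddSubgroup ℝ :=
    { carrier := {u | ∃ γ ∈ M.Γ, ∀ p, (A (γ p)).re = (A p).re + u}
      add_mem' := by
        rintro u v ⟨γ, hγ, h⟩ ⟨δ, hδ, h'⟩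
        refine ⟨γ * δ, M.Γ.mul_mem hγ hδ, fun p => ?_⟩
        change (A (γ (δ p))).re = _
        rw [h, h']; ring
      zero_mem' := ⟨1, M.Γ.one_mem, fun p => by simp⟩
      neg_mem' := by
        rintro u ⟨γ, hγ, h⟩
        refine ⟨γ⁻¹, M.Γ.inv_mem hγ, fun p => ?_⟩
        have := h (γ⁻¹ p)
        rw [show γ (γ⁻¹ p) = p from γ.apply_symm_apply p] at this
        linarith }
  let V : AddSubgroup ℝ :=
    { carrier := {u | ∃ γ ∈ M.Γ, ∀ p, A (γ p) = A p + u * Complex.I}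
      add_mem' := by
        rintro u v ⟨γ, hγ, h⟩ ⟨δ, hδ, h'⟩
        refine ⟨γ * δ, M.Γ.mul_mem hγ hδ, fun p => ?_⟩
        change A (γ (δ p)) = _
        rw [h, h']; push_cast; ring
      zero_mem' := ⟨1, M.Γ.one_mem, fun p => by simp⟩
      neg_mem' := by
        rintro u ⟨γ, hγ, h⟩
        refine ⟨γ⁻¹, M.Γ.inv_mem hγ, fun p => ?_⟩
        have := h (γ⁻¹ p)
        rw [show γ (γ⁻¹ p) = p from γ.apply_symm_apply p] at this
        rw [this]; push_cast; ring }
  let H : AddSubgroup ℝ :=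
    { carrier := {u | ∃ γ ∈ M.Γ, ∃ w : ℂ, w.re = u ∧ ∀ p, A (γ p) = A p + w}
      add_mem' := by
        rintro u v ⟨γ, hγ, w, rfl, h⟩ ⟨δ, hδ, w', rfl, h'⟩
        refine ⟨γ * δ, M.Γ.mul_mem hγ hδ, w + w', Complex.add_re _ _, fun p => ?_⟩
        change A (γ (δ p)) = _
        rw [h, h']; ring
      zero_mem' := ⟨1, M.Γ.one_mem, 0, rfl, fun p => by simp⟩
      neg_mem' := by
        rintro u ⟨γ, hγ, w, rfl, h⟩
        refine ⟨γ⁻¹, M.Γ.inv_mem hγ, -w, Complex.neg_re _, fun p => ?_⟩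
        have := h (γ⁻¹ p)
        rw [show γ (γ⁻¹ p) = p from γ.apply_symm_apply p] at this
        rw [this]; ring }
  have hUfin : ((U : Set ℝ) ∩ Set.Ioo 0 1).Finite := by
    refine ((M.finite_orbit_inter_closedBall o 2).image
      (fun γ : M.Γ => (A ((γ : PlaneIsometry) o)).re / 2)).subset ?_
    rintro u ⟨⟨γ, hγ, h⟩, hu0, hu1⟩
    -- A small horizontal displacement `u` may come with a large vertical one, so discreteness does
    -- not apply to `γ` directly. The square of a glide reflection, or a translation times its
    -- conjugate by `g`, cancels the vertical part and leaves the translation by `2u`, of length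
    -- less than `2`.
    have hT : ∃ δ ∈ M.Γ, ∀ p, A (δ p) = A p + (2 * u : ℝ) := by
      obtain ⟨w, hw⟩ | ⟨w, hw⟩ := hform γ hγ
      · have hwu : w.re = u := by
          have := h o
          rw [hw, Complex.add_re] at this
          linarith
        refine ⟨γ * (g * γ * g⁻¹), M.Γ.mul_mem hγ (M.Γ.mul_mem (M.Γ.mul_mem hg hγ)
          (M.Γ.inv_mem hg)), fun p => ?_⟩
        change A (γ (g (γ (g⁻¹ p)))) = _
        have hp : A p = conj (A (g⁻¹ p)) + w₀ := by
          rw [← hgw, show g (g⁻¹ p) = p from g.apply_symm_apply p]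
        rw [hw, hgw, hw, hp, map_add, ← hwu]
        have := Complex.add_conj w
        push_cast at this ⊢
        linear_combination this
      · have hwu : w.re = u := by
          have := h o
          rw [hw, Complex.add_re, Complex.conj_re] at this
          linarith
        refine ⟨γ * γ, M.Γ.mul_mem hγ hγ, fun p => ?_⟩
        change A (γ (γ p)) = _
        rw [hw, hw, map_add, Complex.conj_conj, ← hwu]
        have := Complex.add_conj w
        push_cast at this ⊢
        linear_combination this
    obtain ⟨δ, hδ, hδu⟩ := hT
    refine ⟨⟨δ, hδ⟩, ?_, ?_⟩
    · change dist (δ o) o ≤ 2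
      rw [← A.dist_map, hδu, dist_eq_norm, add_sub_cancel_left, Complex.norm_real, Real.norm_eq_abs,
        abs_of_pos (by linarith)]
      linarith
    · simp [hδu, hAo]
  have hVfin : ((V : Set ℝ) ∩ Set.Ioo 0 1).Finite := by
    refine ((M.finite_orbit_inter_closedBall o 2).image
      (fun γ : M.Γ => (A ((γ : PlaneIsometry) o)).im)).subset ?_
    rintro u ⟨⟨γ, hγ, h⟩, hu0, hu1⟩
    refine ⟨⟨γ, hγ⟩, ?_, ?_⟩
    · change dist (γ o) o ≤ 2
      rw [← A.dist_map, h, dist_eq_norm, add_sub_cancel_left, norm_mul, Complex.norm_I, mul_one,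
        Complex.norm_real, Real.norm_eq_abs, abs_of_pos hu0]
      linarith
    · simp [h, hAo]
  have hgU : w₀.re ∈ U := ⟨g, hg, fun p => by rw [hgw]; simp⟩
  obtain ⟨a, ha, hUa⟩ := AddSubgroup.exists_pos_forall_mem_iff hUfin ⟨_, hgU, hglide g hg _ hgw⟩
  -- elements that do not move points horizontally
  have hker : ∀ γ ∈ M.Γ, (∀ p, (A (γ p)).re = (A p).re) →
      ∃ v ∈ V, ∀ p, A (γ p) = A p + (v : ℝ) * Complex.I := by
    intro γ hγ h
    obtain ⟨w, hw⟩ | ⟨w, hw⟩ := hform γ hγ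
    · have hw0 : w.re = 0 := by
        have := h o
        rw [hw, Complex.add_re] at this
        linarith
      have : ∀ p, A (γ p) = A p + (w.im : ℝ) * Complex.I := by
        intro p
        rw [hw]
        apply Complex.ext <;> simp [hw0]
      exact ⟨w.im, ⟨γ, hγ, this⟩, this⟩
    · refine absurd ?_ (hglide γ hγ w hw)
      have := h o
      rw [hw, Complex.add_re, Complex.conj_re] at this
      linarith
  obtain ⟨γ₁, hγ₁, hγ₁a⟩ := (hUa a).2 ⟨1, by simp⟩
  have hγ₁g : ∃ w, ∀ p, A (γ₁ p) = conj (A p) + w := by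
    obtain ⟨w, hw⟩ | h := hform γ₁ hγ₁
    · exfalso
      have hwa : w.re = a := by
        have := hγ₁a o
        rw [hw, Complex.add_re] at this
        linarith
      obtain ⟨k, hk⟩ := (hUa _).1 hgU
      -- If the element of displacement `a` were a translation, a translation `δ` would have the
      -- same horizontal displacement as `g`. Then `δ⁻¹ g` would be a reflection without glide,
      -- contradicting `hglide`.
      have hH : w₀.re ∈ H := by
        rw [hk, ← zsmul_eq_mul]
        exact H.zsmul_mem ⟨γ₁, hγ₁, w, hwa, hw⟩ k
      obtain ⟨δ, hδ, w', hw', hδw⟩ := hH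
      refine hglide (δ⁻¹ * g) (M.Γ.mul_mem (M.Γ.inv_mem hδ) hg) (w₀ - w') (fun p => ?_) ?_
      · have := hδw (δ⁻¹ (g p))
        rw [show δ (δ⁻¹ (g p)) = g p from δ.apply_symm_apply _, hgw] at this
        change A (δ⁻¹ (g p)) = _
        linear_combination -this
      · simp [hw']
    · exact h
  obtain ⟨w₁, hw₁⟩ := hγ₁g
  have hw₁a : w₁.re = a := by
    have := hγ₁a o
    rw [hw₁, Complex.add_re, Complex.conj_re] at this
    linarith
  -- move the origin onto the axis of `γ₁`
  let B : Plane ≃ᵃⁱ[ℝ] ℂ :=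
    A.trans (AffineIsometryEquiv.constVAdd ℝ ℂ (-((w₁.im / 2 : ℝ) * Complex.I)))
  have hB : ∀ p, B p = A p - (w₁.im / 2 : ℝ) * Complex.I := by
    intro p
    change -((w₁.im / 2 : ℝ) * Complex.I) + A p = _
    ring
  have hBre : ∀ p, (B p).re = (A p).re := by intro p; rw [hB]; simp
  have hBim : ∀ p, (B p).im = (A p).im - w₁.im / 2 := by intro p; rw [hB]; simp
  have hpow : ∀ k : ℤ, ∃ γ ∈ M.Γ, ∀ p,
      (B (γ p)).re = (B p).re + k * a ∧ (B (γ p)).im = (-1) ^ k * (B p).im := by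
    have hre : ∀ p, (B (γ₁ p)).re = (B p).re + a := by
      intro p; rw [hBre, hBre, hγ₁a]
    have him : ∀ p, (B (γ₁ p)).im = -(B p).im := by
      intro p; rw [hBim, hBim, hw₁]; simp; ring
    intro k
    induction k using Int.induction_on with
    | zero => exact ⟨1, M.Γ.one_mem, fun p => by simp⟩
    | succ k ih =>
      obtain ⟨γ, hγ, h⟩ := ih
      refine ⟨γ₁ * γ, M.Γ.mul_mem hγ₁ hγ, fun p => ?_⟩
      change (B (γ₁ (γ p))).re = _ ∧ (B (γ₁ (γ p))).im = _
      rw [hre, him, (h p).1, (h p).2, zpow_add_one₀ (by norm_num)]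
      constructor
      · push_cast; ring
      · ring
    | pred k ih =>
      obtain ⟨γ, hγ, h⟩ := ih
      refine ⟨γ₁⁻¹ * γ, M.Γ.mul_mem (M.Γ.inv_mem hγ₁) hγ, fun p => ?_⟩
      change (B (γ₁⁻¹ (γ p))).re = _ ∧ (B (γ₁⁻¹ (γ p))).im = _
      have e1 := hre (γ₁⁻¹ (γ p))
      have e2 := him (γ₁⁻¹ (γ p))
      rw [show γ₁ (γ₁⁻¹ (γ p)) = γ p from γ₁.apply_symm_apply _] at e1 e2
      rw [(h p).1] at e1
      rw [(h p).2] at e2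
      rw [zpow_sub_one₀ (by norm_num)]
      constructor
      · push_cast at e1 ⊢; linarith
      · rw [show ((-1 : ℝ))⁻¹ = -1 by norm_num]; linarith
  have horb : ∀ γ ∈ M.Γ, ∃ k : ℤ, ∃ v ∈ V, ∀ p,
      (B (γ p)).re = (B p).re + k * a ∧ (B (γ p)).im = (-1) ^ k * (B p).im + v := by
    intro γ hγ
    have hre : ∃ u, ∀ p, (A (γ p)).re = (A p).re + u := by
      obtain ⟨w, hw⟩ | ⟨w, hw⟩ := hform γ hγ
      · exact ⟨w.re, fun p => by rw [hw]; simp⟩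
      · exact ⟨w.re, fun p => by rw [hw]; simp⟩
    obtain ⟨u, hu⟩ := hre
    obtain ⟨k, rfl⟩ := (hUa u).1 ⟨γ, hγ, hu⟩
    obtain ⟨δ, hδ, h⟩ := hpow k
    have hδre : ∀ p, (A (δ p)).re = (A p).re + k * a := by
      intro p; rw [← hBre, ← hBre, (h p).1]
    -- Removing a power of the glide leaves an element without horizontal displacement, hence a
    -- vertical translation.
    obtain ⟨v, hv, hγδ⟩ := hker (γ * δ⁻¹) (M.Γ.mul_mem hγ (M.Γ.inv_mem hδ)) (by
      intro p
      change (A (γ (δ⁻¹ p))).re = _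
      have := hδre (δ⁻¹ p)
      rw [show δ (δ⁻¹ p) = p from δ.apply_symm_apply _] at this
      rw [hu, this])
    refine ⟨k, v, hv, fun p => ⟨by rw [hBre, hBre, hu], ?_⟩⟩
    have h1 := hγδ (δ p)
    rw [show (γ * δ⁻¹) (δ p) = γ p from congrArg γ (δ.symm_apply_apply p)] at h1
    have h2 := (h p).2
    rw [hBim] at h2
    rw [hBim, h1]
    simp only [Complex.add_im, Complex.mul_im, Complex.ofReal_re, Complex.I_im, mul_one,
      Complex.ofReal_im, Complex.I_re, mul_zero, add_zero]
    linarith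
  have hVne : ∃ v ∈ V, v ≠ 0 := by
    -- Without vertical translations `|Im|` would be invariant under the deck group and descend to
    -- an unbounded continuous function on a compact quotient.
    by_contra! hV
    let Y : MulAction.orbitRel.Quotient M.Γ Plane → ℝ :=
      Quotient.lift (fun p => |(B p).im|) (by
        intro p q hpq
        obtain ⟨⟨γ, hγ⟩, rfl⟩ := (MulAction.orbitRel_apply.1 hpq)
        obtain ⟨k, v, hv, h⟩ := horb γ hγ
        change |(B (γ q)).im| = _
        rw [(h q).2, hV v hv, add_zero, abs_mul, abs_zpow]
        simp)
    have hY : Continuous Y := by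
      refine Continuous.quotient_lift ?_ _
      exact (Complex.continuous_im.comp B.continuous).abs
    have := M.compact
    obtain ⟨C, hC⟩ := (isCompact_range hY).bddAbove
    have h1 : Y (Quotient.mk _ (B.symm ((|C| + 1 : ℝ) * Complex.I))) ≤ C := hC ⟨_, rfl⟩
    change |(B (B.symm ((|C| + 1 : ℝ) * Complex.I))).im| ≤ C at h1
    rw [AffineIsometryEquiv.apply_symm_apply] at h1
    simp only [Complex.mul_im, Complex.ofReal_re, Complex.I_im, mul_one, Complex.ofReal_im,
      Complex.I_re, mul_zero, add_zero] at h1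
    have h2 := le_abs_self (|C| + 1)
    have h3 := le_abs_self C
    linarith
  obtain ⟨b, hb, hVb⟩ := AddSubgroup.exists_pos_forall_mem_iff hVfin hVne
  refine ⟨⟨a, b, ha, hb, B, fun p q => ?_⟩⟩
  rw [M.proj_eq_iff]
  constructor
  · rintro ⟨γ, hγ, rfl⟩
    obtain ⟨k, v, hv, h⟩ := horb γ hγ
    obtain ⟨l, rfl⟩ := (hVb v).1 hv
    exact ⟨k, l, h q⟩
  · rintro ⟨k, l, h1, h2⟩
    obtain ⟨γ, hγ, h⟩ := hpow k
    obtain ⟨τ, hτ, hτl⟩ := (hVb (l * b)).2 ⟨l, rfl⟩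
    refine ⟨τ * γ, M.Γ.mul_mem hτ hγ, B.injective ?_⟩
    change B (τ (γ q)) = B p
    apply Complex.ext
    · rw [hBre, hτl, h1, ← (h q).1, hBre]; simp
    · have := (h q).2
      rw [hBim, hτl, h2, ← this, hBim]; simp; ring

variable {M}

/-! ### The covering map, a fundamental rectangle and the area measure. -/

theorem continuous_proj : Continuous M.proj :=
  (LipschitzWith.of_dist_le_mul (K := 1) fun p q => by
    simpa using M.dist_proj_le p q).continuous

theorem isOpenMap_proj : IsOpenMap M.proj := by
  intro U hU
  rw [Metric.isOpen_iff]
  rintro _ ⟨p, hp, rfl⟩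
  obtain ⟨ε, hε, h⟩ := Metric.isOpen_iff.1 hU p hp
  refine ⟨ε, hε, fun y hy => ?_⟩
  obtain ⟨q, rfl, hq⟩ := M.exists_dist_lt p y (by rwa [dist_comm])
  exact ⟨q, h (by rwa [Metric.mem_ball, dist_comm]), rfl⟩

theorem isQuotientMap_proj : Topology.IsQuotientMap M.proj :=
  isOpenMap_proj.isQuotientMap continuous_proj M.proj_surjective

namespace Frame

variable (F : M.Frame)

/-- The point of the plane with given coordinates. -/
def toPlane (z : ℝ × ℝ) : Plane := F.A.symm ⟨z.1, z.2⟩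

/-- The point of the Klein bottle with given coordinates. -/
def chart (z : ℝ × ℝ) : M.Carrier := M.proj (F.toPlane z)

theorem A_toPlane (z : ℝ × ℝ) : F.A (F.toPlane z) = ⟨z.1, z.2⟩ := F.A.apply_symm_apply _

theorem toPlane_coord (p : Plane) : F.toPlane ((F.A p).re, (F.A p).im) = p :=
  F.A.symm_apply_apply p

theorem chart_coord (p : Plane) : F.chart ((F.A p).re, (F.A p).im) = M.proj p :=
  congrArg M.proj (F.toPlane_coord p)

theorem toPlane_injective : Function.Injective F.toPlane := by
  intro z w h
  have := F.A.symm.injective h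
  rw [Complex.mk.injEq] at this
  exact Prod.ext this.1 this.2

theorem continuous_toPlane : Continuous F.toPlane :=
  F.A.symm.continuous.comp (Complex.equivRealProdCLM.symm.continuous)

theorem continuous_chart : Continuous F.chart := continuous_proj.comp F.continuous_toPlane

theorem chart_eq (z w : ℝ × ℝ) : F.chart z = F.chart w ↔ ∃ k l : ℤ,
    z.1 = w.1 + k * F.a ∧ z.2 = (-1) ^ k * w.2 + l * F.b := by
  rw [chart, chart, F.proj_eq, A_toPlane, A_toPlane]

/-- A rectangle that represents every point of the Klein bottle once. -/
def domain : Set (ℝ × ℝ) := Set.Ioc 0 F.a ×ˢ Set.Ioc 0 F.b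

theorem measurableSet_domain : MeasurableSet F.domain := measurableSet_Ioc.prod measurableSet_Ioc

theorem exists_chart_eq (x : M.Carrier) : ∃ z ∈ F.domain, F.chart z = x := by
  obtain ⟨p, rfl⟩ := M.proj_surjective x
  rw [← F.chart_coord p]
  set x := (F.A p).re
  set y := (F.A p).im
  obtain ⟨k, hk, -⟩ := existsUnique_add_zsmul_mem_Ioc F.a_pos x 0
  obtain ⟨l, hl, -⟩ := existsUnique_add_zsmul_mem_Ioc F.b_pos ((-1) ^ k * y) 0
  rw [zero_add, zsmul_eq_mul] at hk hl
  exact ⟨(x + k * F.a, (-1) ^ k * y + l * F.b), ⟨hk, hl⟩,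
    (F.chart_eq _ _).2 ⟨k, l, rfl, rfl⟩⟩

theorem eq_zero_of_lt {c u v : ℝ} (hc : 0 < c) {k : ℤ} (h : u = v + k * c) (huv : |u - v| < c) :
    k = 0 := by
  rw [h, add_sub_cancel_left, abs_mul, abs_of_pos hc] at huv
  have h1 : |(k : ℝ)| < 1 := by
    by_contra! hle
    nlinarith
  exact Int.abs_lt_one_iff.1 (by exact_mod_cast h1)

theorem injOn_chart : Set.InjOn F.chart F.domain := by
  rintro ⟨x, y⟩ ⟨hx, hy⟩ ⟨x', y'⟩ ⟨hx', hy'⟩ h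
  obtain ⟨k, l, h1, h2⟩ := (F.chart_eq _ _).1 h
  simp only [Set.mem_Ioc] at hx hy hx' hy' h1 h2
  have hk : k = 0 := eq_zero_of_lt F.a_pos h1 (by rw [abs_lt]; constructor <;> linarith)
  subst hk
  rw [zpow_zero, one_mul] at h2
  have hl : l = 0 := eq_zero_of_lt F.b_pos h2 (by rw [abs_lt]; constructor <;> linarith)
  subst hl
  simp at h1 h2
  rw [h1, h2]

/-- Distinct points of one fibre of the universal covering are far apart. -/
theorem le_dist_of_proj_eq {p q : Plane} (h : M.proj p = M.proj q) (hne : p ≠ q) :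
    min F.a F.b ≤ dist p q := by
  by_contra! hlt
  obtain ⟨k, l, h1, h2⟩ := (F.proj_eq p q).1 h
  rw [← F.A.dist_map, Complex.dist_eq] at hlt
  have hre := (Complex.abs_re_le_norm _).trans_lt (hlt.trans_le (min_le_left _ _))
  have him := (Complex.abs_im_le_norm _).trans_lt (hlt.trans_le (min_le_right _ _))
  rw [Complex.sub_re] at hre
  rw [Complex.sub_im] at him
  have hk : k = 0 := eq_zero_of_lt F.a_pos h1 hre
  subst hk
  rw [zpow_zero, one_mul] at h2
  have hl : l = 0 := eq_zero_of_lt F.b_pos h2 him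
  subst hl
  simp at h1 h2
  exact hne (F.A.injective (Complex.ext h1 h2))

/-- A point `q'` of the fibre of `q` closer to `p` than `q` would satisfy `dist q' q < 2 * (min a b
/ 2)`, below the minimal separation within a fibre. The covering is thus isometric on sets of small
diameter, which is what transfers Hausdorff measure. -/
theorem dist_proj_eq {p q : Plane} (h : dist p q ≤ min F.a F.b / 2) :
    dist (M.proj p) (M.proj q) = dist p q := by
  refine le_antisymm (M.dist_proj_le p q) (le_of_not_gt fun hlt => ?_)
  obtain ⟨q', hq', hlt'⟩ := M.exists_dist_lt p _ hlt
  have hne : q' ≠ q := by rintro rfl; exact lt_irrefl _ hlt'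
  have h1 := F.le_dist_of_proj_eq hq' hne
  have h2 := dist_triangle_left q' q p
  linarith

theorem area_image_proj {t : Set Plane} (ht : ∀ p ∈ t, ∀ q ∈ t, dist p q ≤ min F.a F.b / 2) :
    M.area (M.proj '' t) = volume t := by
  have hiso : Isometry (fun p : t => M.proj p) :=
    Isometry.of_dist_eq fun p q => F.dist_proj_eq (ht p p.2 q q.2)
  have h1 : M.proj '' t = (fun p : t => M.proj p) '' Set.univ := by
    rw [Set.image_univ, Set.image_eq_range]
  have h2 := (isometry_subtype_coe (s := t)).euclideanHausdorffMeasure_image (d := 2) Set.univ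
  rw [area, h1, hiso.euclideanHausdorffMeasure_image, ← h2, Set.image_univ, Subtype.range_coe,
    EuclideanSpace.euclideanHausdorffMeasure_eq_volume]

theorem measurePreserving_toPlane : MeasurePreserving F.toPlane volume volume := by
  have h1 := F.A.symm.toIsometryEquiv.measurePreserving_euclideanHausdorffMeasure 2
  have h2 : (μHE[2] : Measure ℂ) = volume := by
    rw [← InnerProductSpace.euclideanHausdorffMeasure_eq_volume, Complex.finrank_real_complex]
  rw [EuclideanSpace.euclideanHausdorffMeasure_eq_volume, h2] at h1
  exact h1.comp Complex.volume_preserving_equiv_real_prod.symm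

theorem volume_image_toPlane (s : Set (ℝ × ℝ)) : volume (F.toPlane '' s) = volume s := by
  have hc : F.toPlane = Complex.equivRealProdCLM.symm.toHomeomorph.trans
    F.A.symm.toHomeomorph := rfl
  have he : MeasurableEmbedding F.toPlane := by
    rw [hc]
    exact (Homeomorph.measurableEmbedding _)
  rw [← F.measurePreserving_toPlane.map_eq, he.map_apply,
    Set.preimage_image_eq _ F.toPlane_injective]

/-- The area of the Klein bottle is Lebesgue measure in the coordinates. -/
theorem measurePreserving_chart :
    MeasurePreserving F.chart (volume.restrict F.domain) M.area := by
  refine ⟨F.continuous_chart.measurable, ?_⟩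
  ext S hS
  have hS' := F.continuous_chart.measurable hS
  rw [Measure.map_apply F.continuous_chart.measurable hS, Measure.restrict_apply hS']
  -- Balls of radius `min a b / 4` have diameter at most `min a b / 2`, the scale on which the
  -- projection is isometric. The rectangle is cut into countably many measurable pieces, each
  -- inside such a ball.
  set r := min F.a F.b / 4 with hr
  have hr0 : 0 < r := by have := lt_min F.a_pos F.b_pos; positivity
  let c : ℕ → ℝ × ℝ := TopologicalSpace.denseSeq (ℝ × ℝ)
  let B : ℕ → Set (ℝ × ℝ) := fun n => F.toPlane ⁻¹' Metric.ball (F.toPlane (c n)) r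
  have hB : ⋃ n, B n = Set.univ := by
    rw [Set.eq_univ_iff_forall]
    intro z
    have hopen : IsOpen (F.toPlane ⁻¹' Metric.ball (F.toPlane z) r) :=
      Metric.isOpen_ball.preimage F.continuous_toPlane
    obtain ⟨_, hw, n, rfl⟩ := (TopologicalSpace.denseRange_denseSeq (ℝ × ℝ)).inter_open_nonempty _
      hopen ⟨z, Metric.mem_ball_self hr0⟩
    refine Set.mem_iUnion.2 ⟨n, ?_⟩
    change dist _ _ < r
    rw [dist_comm]
    exact hw
  have hBm : ∀ n, MeasurableSet (B n) := fun n =>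
    (Metric.isOpen_ball.preimage F.continuous_toPlane).measurableSet
  let Q : ℕ → Set (ℝ × ℝ) := fun n => disjointed B n ∩ (F.chart ⁻¹' S ∩ F.domain)
  have hQm : ∀ n, MeasurableSet (Q n) := fun n =>
    (MeasurableSet.disjointed hBm n).inter (hS'.inter F.measurableSet_domain)
  have hQd : Pairwise (Function.onFun Disjoint Q) := fun m n hmn =>
    (disjoint_disjointed B hmn).mono Set.inter_subset_left Set.inter_subset_left
  have hQu : ⋃ n, Q n = F.chart ⁻¹' S ∩ F.domain := by
    rw [← Set.iUnion_inter, iUnion_disjointed, hB, Set.univ_inter]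
  have hQdom : ∀ n, Q n ⊆ F.domain := fun n z hz => hz.2.2
  have himg : S = ⋃ n, F.chart '' Q n := by
    rw [← Set.image_iUnion, hQu]
    apply Set.Subset.antisymm
    · intro x hx
      obtain ⟨z, hz, rfl⟩ := F.exists_chart_eq x
      exact ⟨z, ⟨hx, hz⟩, rfl⟩
    · rintro _ ⟨z, hz, rfl⟩
      exact hz.1
  rw [← hQu]
  conv_rhs => rw [himg]
  rw [measure_iUnion hQd hQm, measure_iUnion]
  · refine tsum_congr fun n => ?_
    rw [show F.chart '' Q n = M.proj '' (F.toPlane '' Q n) from Set.image_comp M.proj F.toPlane _,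
      F.area_image_proj, F.volume_image_toPlane]
    rintro _ ⟨z, hz, rfl⟩ _ ⟨w, hw, rfl⟩
    have h1 : dist (F.toPlane z) (F.toPlane (c n)) < r := disjointed_subset B n hz.1
    have h2 : dist (F.toPlane w) (F.toPlane (c n)) < r := disjointed_subset B n hw.1
    have h3 := dist_triangle_right (F.toPlane z) (F.toPlane w) (F.toPlane (c n))
    linarith
  · intro m n hmn
    change Disjoint _ _
    rw [Set.disjoint_left]
    rintro _ ⟨z, hz, rfl⟩ ⟨w, hw, h⟩
    have := F.injOn_chart (hQdom _ hw) (hQdom _ hz) h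
    subst this
    exact Set.disjoint_left.1 (hQd hmn) hz hw
  · exact fun n => (hQm n).image_of_continuousOn_injOn F.continuous_chart.continuousOn
      (F.injOn_chart.mono (hQdom n))

theorem compactSpace (F : M.Frame) : CompactSpace M.Carrier := by
  have hK : IsCompact (Set.Icc 0 F.a ×ˢ Set.Icc 0 F.b) := isCompact_Icc.prod isCompact_Icc
  refine ⟨?_⟩
  convert hK.image F.continuous_chart
  refine (Set.eq_univ_of_forall fun x => ?_).symm
  obtain ⟨z, hz, rfl⟩ := F.exists_chart_eq x
  exact ⟨z, ⟨Set.Ioc_subset_Icc_self hz.1, Set.Ioc_subset_Icc_self hz.2⟩, rfl⟩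

theorem integral_area (f : M.Carrier → ℂ) (hf : Continuous f) :
    ∫ x, f x ∂M.area = ∫ z in F.domain, f (F.chart z) := by
  rw [← F.measurePreserving_chart.map_eq,
    integral_map F.continuous_chart.measurable.aemeasurable hf.measurable.aestronglyMeasurable]

/-- Continuous functions that agree almost everywhere are equal. -/
theorem eq_of_ae_eq (F : M.Frame) {f g : M.Carrier → ℂ} (hf : Continuous f) (hg : Continuous g)
    (h : f =ᵐ[M.area] g) : f = g := by
  have h1 : (f ∘ F.chart) =ᵐ[volume.restrict F.domain] (g ∘ F.chart) :=
    F.measurePreserving_chart.quasiMeasurePreserving.ae_eq_comp h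
  -- The rectangle is half-open; its edges lie in the closure of its interior, so almost everywhere
  -- equality of continuous functions extends to them.
  have hcl : F.domain ⊆ closure (interior F.domain) := by
    rw [domain, interior_prod_eq, interior_Ioc, interior_Ioc, closure_prod_eq,
      closure_Ioo F.a_pos.ne, closure_Ioo F.b_pos.ne]
    exact Set.prod_mono Set.Ioc_subset_Icc_self Set.Ioc_subset_Icc_self
  have h2 := Measure.eqOn_of_ae_eq h1 (hf.comp F.continuous_chart).continuousOn
    (hg.comp F.continuous_chart).continuousOn hcl
  funext x
  obtain ⟨z, hz, rfl⟩ := F.exists_chart_eq x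
  exact h2 hz

end Frame

instance instCompactSpace : CompactSpace M.Carrier := M.nonempty_frame.some.compactSpace

instance instIsFiniteMeasure : IsFiniteMeasure M.area := by
  let F := M.nonempty_frame.some
  rw [← F.measurePreserving_chart.map_eq]
  have : IsFiniteMeasure ((volume : Measure (ℝ × ℝ)).restrict F.domain) := by
    refine ⟨?_⟩
    rw [Measure.restrict_apply_univ, Frame.domain, Measure.volume_eq_prod, Measure.prod_prod]
    simp only [Real.volume_Ioc]
    exact ENNReal.mul_lt_top ENNReal.ofReal_lt_top ENNReal.ofReal_lt_top
  exact Measure.isFiniteMeasure_map _ _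

namespace Frame

variable (F : M.Frame)

/-! ### The Laplacian in the coordinates. -/

/-- The linear part of `Frame.toPlane`. -/
def linearToPlane : ℝ × ℝ →L[ℝ] Plane :=
  (F.A.symm.linearIsometryEquiv.toContinuousLinearEquiv : ℂ →L[ℝ] Plane).comp
    (Complex.equivRealProdCLM.symm : ℝ × ℝ →L[ℝ] ℂ)

theorem toPlane_eq (z : ℝ × ℝ) : F.toPlane z = F.linearToPlane z + F.toPlane 0 := by
  have h := F.A.symm.map_vadd 0 (Complex.equivRealProdCLM.symm z)
  simp only [vadd_eq_add, add_zero] at h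
  exact h

theorem hasFDerivAt_toPlane (z : ℝ × ℝ) : HasFDerivAt F.toPlane F.linearToPlane z := by
  rw [show F.toPlane = fun z => F.linearToPlane z + F.toPlane 0 from funext F.toPlane_eq]
  exact F.linearToPlane.hasFDerivAt.add_const _

theorem contDiff_toPlane {n : WithTop ℕ∞} : ContDiff ℝ n F.toPlane := by
  rw [show F.toPlane = fun z => F.linearToPlane z + F.toPlane 0 from funext F.toPlane_eq]
  exact F.linearToPlane.contDiff.add contDiff_const

/-- The coordinates of a point of the plane. -/
def coord (p : Plane) : ℝ × ℝ := ((F.A p).re, (F.A p).im)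

theorem coord_toPlane (z : ℝ × ℝ) : F.coord (F.toPlane z) = z := by
  rw [coord, A_toPlane]

theorem toPlane_coord' (p : Plane) : F.toPlane (F.coord p) = p := F.toPlane_coord p

theorem contDiff_coord {n : WithTop ℕ∞} : ContDiff ℝ n F.coord := by
  have hA : ContDiff ℝ n F.A := by
    have : ⇑F.A = fun p => F.A.linearIsometryEquiv p + F.A 0 := by
      funext p
      have h := F.A.map_vadd 0 p
      simp only [vadd_eq_add, add_zero] at h
      exact h
    rw [this]
    exact F.A.linearIsometryEquiv.contDiff.add contDiff_const
  exact Complex.equivRealProdCLM.contDiff.comp hA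

theorem fderiv_comp_toPlane {f : Plane → ℂ} (hf : ContDiff ℝ 2 f) (e : ℝ × ℝ) :
    (fun z => fderiv ℝ (f ∘ F.toPlane) z e) =
      fun z => fderiv ℝ f (F.toPlane z) (F.linearToPlane e) := by
  funext z
  have h := ((hf.differentiable two_ne_zero) (F.toPlane z)).hasFDerivAt.comp z
    (F.hasFDerivAt_toPlane z)
  rw [h.fderiv]
  rfl

theorem fderiv_fderiv_comp_toPlane {f : Plane → ℂ} (hf : ContDiff ℝ 2 f) (e : ℝ × ℝ)
    (z : ℝ × ℝ) :
    fderiv ℝ (fun z => fderiv ℝ (f ∘ F.toPlane) z e) z e =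
      fderiv ℝ (fderiv ℝ f) (F.toPlane z) (F.linearToPlane e) (F.linearToPlane e) := by
  rw [F.fderiv_comp_toPlane hf]
  have h1 : Differentiable ℝ (fderiv ℝ f) :=
    (hf.fderiv_right (m := 1) (by norm_num)).differentiable one_ne_zero
  have h2 := (h1 (F.toPlane z)).hasFDerivAt.comp z (F.hasFDerivAt_toPlane z)
  have h3 := h2.clm_apply (hasFDerivAt_const (F.linearToPlane e) z)
  have h4 : (fun z => fderiv ℝ f (F.toPlane z) (F.linearToPlane e)) =
    fun z => (fderiv ℝ f ∘ F.toPlane) z (F.linearToPlane e) := rfl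
  rw [h4, h3.fderiv]
  simp

/-- The Laplacian in the coordinates. -/
theorem laplacian_toPlane {f : Plane → ℂ} (hf : ContDiff ℝ 2 f) (z : ℝ × ℝ) :
    Δ f (F.toPlane z) =
      fderiv ℝ (fun z => fderiv ℝ (f ∘ F.toPlane) z (1, 0)) z (1, 0) +
      fderiv ℝ (fun z => fderiv ℝ (f ∘ F.toPlane) z (0, 1)) z (0, 1) := by
  rw [F.fderiv_fderiv_comp_toPlane hf, F.fderiv_fderiv_comp_toPlane hf,
    laplacian_eq_iteratedFDeriv_orthonormalBasis f
      (Complex.orthonormalBasisOneI.map F.A.symm.linearIsometryEquiv)]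
  have e1 : F.linearToPlane (1, 0) = F.A.symm.linearIsometryEquiv 1 := by
    change F.A.symm.linearIsometryEquiv _ = _
    congr 1
  have e2 : F.linearToPlane (0, 1) = F.A.symm.linearIsometryEquiv Complex.I := by
    change F.A.symm.linearIsometryEquiv _ = _
    congr 1
  simp only [Fin.sum_univ_two, iteratedFDeriv_two_apply, e1, e2]
  simp

theorem fderiv_apply_fst {G : ℝ × ℝ → ℂ} {z : ℝ × ℝ} (hG : DifferentiableAt ℝ G z) {d : ℂ}
    (h : HasDerivAt (fun t => G (t, z.2)) d z.1) : fderiv ℝ G z (1, 0) = d := by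
  have h1 : HasDerivAt (fun t : ℝ => (t, z.2)) ((1 : ℝ), (0 : ℝ)) z.1 :=
    (hasDerivAt_id z.1).prodMk (hasDerivAt_const z.1 z.2)
  exact (HasFDerivAt.comp_hasDerivAt z.1 (f := fun t : ℝ => (t, z.2)) hG.hasFDerivAt h1).unique h

theorem fderiv_apply_snd {G : ℝ × ℝ → ℂ} {z : ℝ × ℝ} (hG : DifferentiableAt ℝ G z) {d : ℂ}
    (h : HasDerivAt (fun t => G (z.1, t)) d z.2) : fderiv ℝ G z (0, 1) = d := by
  have h1 : HasDerivAt (fun t : ℝ => (z.1, t)) ((0 : ℝ), (1 : ℝ)) z.2 :=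
    (hasDerivAt_const z.2 z.1).prodMk (hasDerivAt_id z.2)
  exact (HasFDerivAt.comp_hasDerivAt z.2 (f := fun t : ℝ => (z.1, t)) hG.hasFDerivAt h1).unique h

/-! ### Separated waves and their frequencies. -/

/-- The cosine for even `m` and the sine for odd `m`. -/
def parityTrig (m : ℤ) (t : ℝ) : ℝ := if Even m then Real.cos t else Real.sin t

theorem parityTrig_even {m : ℤ} (h : Even m) (t : ℝ) : parityTrig m t = Real.cos t := if_pos h

theorem parityTrig_odd {m : ℤ} (h : Odd m) (t : ℝ) : parityTrig m t = Real.sin t :=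
  if_neg (Int.not_even_iff_odd.2 h)

/-- The function `e^{π i m x / a} cos (2 π n y / b)` for even `m`, and
`e^{π i m x / a} sin (2 π n y / b)` for odd `m`. -/
def planeWave (m n : ℤ) (z : ℝ × ℝ) : ℂ :=
  Complex.exp (m * (Real.pi * z.1 / F.a : ℝ) * Complex.I) *
    parityTrig m (n * (2 * Real.pi * z.2 / F.b))

/-- The horizontal shift multiplies the exponential by `(-1)^(mk)`. The reflection `(-1)^k`
multiplies the trigonometric factor by the same sign, since it is even for even `m` and odd for odd
`m`. The two signs cancel. -/
theorem planeWave_add (m n k l : ℤ) (z : ℝ × ℝ) :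
    F.planeWave m n (z.1 + k * F.a, (-1) ^ k * z.2 + l * F.b) = F.planeWave m n z := by
  have ha := F.a_pos.ne'
  have hb := F.b_pos.ne'
  have h1 : Complex.exp (m * (Real.pi * (z.1 + k * F.a) / F.a : ℝ) * Complex.I) =
      (-1) ^ (m * k) * Complex.exp (m * (Real.pi * z.1 / F.a : ℝ) * Complex.I) := by
    rw [← Complex.exp_pi_mul_I, ← Complex.exp_int_mul, ← Complex.exp_add]
    congr 1
    rw [show Real.pi * (z.1 + k * F.a) / F.a = Real.pi * z.1 / F.a + k * Real.pi by field_simp]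
    push_cast
    ring
  have h2 : n * (2 * Real.pi * ((-1) ^ k * z.2 + l * F.b) / F.b) =
      (-1) ^ k * (n * (2 * Real.pi * z.2 / F.b)) + (n * l : ℤ) * (2 * Real.pi) := by
    push_cast
    field_simp
  have h3 : parityTrig m (n * (2 * Real.pi * ((-1) ^ k * z.2 + l * F.b) / F.b)) =
      (-1) ^ (m * k) * parityTrig m (n * (2 * Real.pi * z.2 / F.b)) := by
    rw [h2]
    rcases Int.even_or_odd m with hm | hm
    · rw [parityTrig_even hm, parityTrig_even hm, Real.cos_add_int_mul_two_pi,
        (hm.mul_right k).neg_one_zpow]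
      rcases Int.even_or_odd k with hk | hk
      · rw [hk.neg_one_zpow, one_mul, one_mul]
      · rw [hk.neg_one_zpow, neg_one_mul, Real.cos_neg, one_mul]
    · rw [parityTrig_odd hm, parityTrig_odd hm, Real.sin_add_int_mul_two_pi]
      rcases Int.even_or_odd k with hk | hk
      · rw [hk.neg_one_zpow, (hk.mul_left m).neg_one_zpow, one_mul, one_mul]
      · rw [hk.neg_one_zpow, (hm.mul hk).neg_one_zpow, neg_one_mul, Real.sin_neg, neg_one_mul]
  have h4 : ((-1 : ℂ) ^ (m * k)) * (-1 : ℂ) ^ (m * k) = 1 := by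
    rw [← zpow_add₀ (by norm_num)]
    exact (Even.add_self _).neg_one_zpow
  simp only [planeWave]
  rw [h1, h3]
  push_cast
  linear_combination Complex.exp (m * (Real.pi * z.1 / F.a) * Complex.I) *
    (parityTrig m (n * (2 * Real.pi * z.2 / F.b)) : ℂ) * h4

theorem contDiff_planeWave (m n : ℤ) {N : WithTop ℕ∞} : ContDiff ℝ N (F.planeWave m n) := by
  have h1 : ContDiff ℝ N (fun z : ℝ × ℝ =>
      Complex.exp (m * (Real.pi * z.1 / F.a : ℝ) * Complex.I)) := by
    refine Complex.contDiff_exp.comp ((contDiff_const.mul ?_).mul contDiff_const)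
    exact Complex.ofRealCLM.contDiff.comp ((contDiff_const.mul contDiff_fst).div_const _)
  have h2 : ContDiff ℝ N (fun z : ℝ × ℝ => (n : ℝ) * (2 * Real.pi * z.2 / F.b)) :=
    contDiff_const.mul ((contDiff_const.mul contDiff_snd).div_const _)
  have h3 : ContDiff ℝ N (fun z : ℝ × ℝ => parityTrig m (n * (2 * Real.pi * z.2 / F.b))) := by
    rcases Int.even_or_odd m with hm | hm
    · simp only [parityTrig_even hm]
      exact Real.contDiff_cos.comp h2
    · simp only [parityTrig_odd hm]
      exact Real.contDiff_sin.comp h2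
  exact h1.mul (Complex.ofRealCLM.contDiff.comp h3)

theorem fderiv_planeWave_fst (m n : ℤ) (z : ℝ × ℝ) :
    fderiv ℝ (F.planeWave m n) z (1, 0) = (m * Real.pi / F.a * Complex.I) * F.planeWave m n z := by
  refine fderiv_apply_fst (((F.contDiff_planeWave m n (N := 1)).differentiable one_ne_zero) z) ?_
  have h1 : HasDerivAt (fun t : ℝ => (m : ℂ) * (Real.pi * t / F.a : ℝ) * Complex.I)
      (m * Real.pi / F.a * Complex.I) z.1 := by
    have := (((hasDerivAt_id z.1).const_mul Real.pi).div_const F.a).ofReal_comp.const_mul (m : ℂ)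
      |>.mul_const Complex.I
    refine this.congr_deriv ?_
    push_cast
    ring
  have h2 := (h1.cexp).mul_const (parityTrig m (n * (2 * Real.pi * z.2 / F.b)) : ℂ)
  refine h2.congr_deriv ?_
  simp only [planeWave]
  ring

theorem fderiv_fderiv_planeWave_fst (m n : ℤ) (z : ℝ × ℝ) :
    fderiv ℝ (fun z => fderiv ℝ (F.planeWave m n) z (1, 0)) z (1, 0) =
      -((m * Real.pi / F.a : ℝ) : ℂ) ^ 2 * F.planeWave m n z := by
  have hd := (F.contDiff_planeWave m n (N := 1)).differentiable one_ne_zero z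
  simp only [fderiv_planeWave_fst]
  rw [fderiv_const_mul hd]
  simp only [smul_apply, fderiv_planeWave_fst, smul_eq_mul]
  push_cast
  linear_combination (m * Real.pi / F.a) ^ 2 * F.planeWave m n z * Complex.I_sq

theorem fderiv_fderiv_planeWave_snd (m n : ℤ) (z : ℝ × ℝ) :
    fderiv ℝ (fun z => fderiv ℝ (F.planeWave m n) z (0, 1)) z (0, 1) =
      -((n * (2 * Real.pi) / F.b : ℝ) : ℂ) ^ 2 * F.planeWave m n z := by
  set c : ℝ := n * (2 * Real.pi) / F.b with hc
  have hlin : ∀ t : ℝ, n * (2 * Real.pi * t / F.b) = c * t := fun t => by rw [hc]; ring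
  have hg : ∀ t, HasDerivAt (fun t : ℝ => c * t) c t := fun t => by
    simpa using (hasDerivAt_id t).const_mul c
  have hsm := (F.contDiff_planeWave m n (N := 2))
  have hd := hsm.differentiable two_ne_zero
  have hsm' : ContDiff ℝ 1 (fun z => fderiv ℝ (F.planeWave m n) z (0, 1)) :=
    (hsm.fderiv_right (m := 1) (by norm_num)).clm_apply contDiff_const
  refine fderiv_apply_snd (hsm'.differentiable one_ne_zero z) ?_
  set E : ℂ := Complex.exp (m * (Real.pi * z.1 / F.a : ℝ) * Complex.I) with hE
  rcases Int.even_or_odd m with hm | hm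
  · have h1 : (fun t => fderiv ℝ (F.planeWave m n) (z.1, t) (0, 1)) =
        fun t => E * ((-Real.sin (c * t) * c : ℝ) : ℂ) := by
      funext t
      refine fderiv_apply_snd (hd _) ?_
      simp only [planeWave, parityTrig_even hm, hlin]
      exact ((hg t).cos.ofReal_comp).const_mul _
    rw [h1]
    have h2 := ((((hg z.2).sin.neg).mul_const c).ofReal_comp).const_mul E
    refine h2.congr_deriv ?_
    simp only [planeWave, parityTrig_even hm, hlin, ← hE]
    push_cast
    ring
  · have h1 : (fun t => fderiv ℝ (F.planeWave m n) (z.1, t) (0, 1)) =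
        fun t => E * ((Real.cos (c * t) * c : ℝ) : ℂ) := by
      funext t
      refine fderiv_apply_snd (hd _) ?_
      simp only [planeWave, parityTrig_odd hm, hlin]
      exact ((hg t).sin.ofReal_comp).const_mul _
    rw [h1]
    have h2 := ((((hg z.2).cos).mul_const c).ofReal_comp).const_mul E
    refine h2.congr_deriv ?_
    simp only [planeWave, parityTrig_odd hm, hlin, ← hE]
    push_cast
    ring

theorem coord_eq_of_proj_eq {p q : Plane} (h : M.proj p = M.proj q) : ∃ k l : ℤ,
    F.coord p = ((F.coord q).1 + k * F.a, (-1) ^ k * (F.coord q).2 + l * F.b) := by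
  obtain ⟨k, l, h1, h2⟩ := (F.proj_eq p q).1 h
  exact ⟨k, l, Prod.ext h1 h2⟩

/-- `Frame.planeWave` as a function on the Klein bottle. -/
def wave (m n : ℤ) : C(M.Carrier, ℂ) where
  toFun x := F.planeWave m n (F.coord (Function.surjInv M.proj_surjective x))
  continuous_toFun := by
    rw [isQuotientMap_proj.continuous_iff]
    have : (fun x => F.planeWave m n (F.coord (Function.surjInv M.proj_surjective x))) ∘ M.proj =
        F.planeWave m n ∘ F.coord := by
      funext p
      obtain ⟨k, l, h⟩ := F.coord_eq_of_proj_eq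
        (Function.surjInv_eq M.proj_surjective (M.proj p))
      simp only [Function.comp_apply]
      rw [h, planeWave_add]
    rw [this]
    exact (F.contDiff_planeWave m n (N := 0)).continuous.comp
      (F.contDiff_coord (n := 0)).continuous

theorem wave_proj (m n : ℤ) (p : Plane) : F.wave m n (M.proj p) = F.planeWave m n (F.coord p) := by
  obtain ⟨k, l, h⟩ := F.coord_eq_of_proj_eq (Function.surjInv_eq M.proj_surjective (M.proj p))
  change F.planeWave m n (F.coord _) = _
  rw [h, planeWave_add]

theorem wave_chart (m n : ℤ) (z : ℝ × ℝ) : F.wave m n (F.chart z) = F.planeWave m n z := by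
  rw [chart, wave_proj, coord_toPlane]

theorem wave_comp_proj (m n : ℤ) : F.wave m n ∘ M.proj = F.planeWave m n ∘ F.coord :=
  funext (F.wave_proj m n)

/-- The frequency of `Frame.wave`. -/
def waveFreq (m n : ℤ) : ℝ :=
  √((m * Real.pi / F.a) ^ 2 + (n * (2 * Real.pi) / F.b) ^ 2)

theorem isEigenfunction_wave (m n : ℤ) : M.IsEigenfunction (F.wave m n) (F.waveFreq m n) where
  smooth := by
    rw [wave_comp_proj]
    exact (F.contDiff_planeWave m n).comp F.contDiff_coord
  laplacian_eq p := by
    have h2 : ContDiff ℝ 2 (F.wave m n ∘ M.proj) := by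
      rw [wave_comp_proj]
      exact (F.contDiff_planeWave m n).comp F.contDiff_coord
    have h3 : (F.wave m n ∘ M.proj) ∘ F.toPlane = F.planeWave m n := by
      funext z
      exact F.wave_chart m n z
    have h := F.laplacian_toPlane h2 (F.coord p)
    rw [toPlane_coord', h3, fderiv_fderiv_planeWave_fst, fderiv_fderiv_planeWave_snd] at h
    rw [h, wave_proj, waveFreq, ← Complex.ofReal_pow (√_) 2, Real.sq_sqrt (by positivity)]
    push_cast
    ring

end Frame

/-- A constant multiple of an eigenfunction is an eigenfunction. -/
theorem IsEigenfunction.const_mul {f : M.Carrier → ℂ} {lam : ℝ} (h : M.IsEigenfunction f lam)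
    (c : ℂ) : M.IsEigenfunction (fun x => c * f x) lam where
  smooth := contDiff_const.mul h.smooth
  laplacian_eq p := by
    have h1 : (fun x => c * f x) ∘ M.proj = c • (f ∘ M.proj) := rfl
    rw [h1, laplacian_smul c (h.smooth.of_le (WithTop.coe_le_coe.2 le_top)).contDiffAt,
      h.laplacian_eq, smul_eq_mul]
    ring

theorem IsEigenfunction.continuous {f : M.Carrier → ℂ} {lam : ℝ} (h : M.IsEigenfunction f lam) :
    Continuous f :=
  isQuotientMap_proj.continuous_iff.2 h.smooth.continuous

namespace Frame

variable (F : M.Frame)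

/-! ### Completeness of the waves by Stone–Weierstrass. -/

theorem parityTrig_neg (m : ℤ) (t : ℝ) :
    parityTrig m (-t) = if Even m then parityTrig m t else -parityTrig m t := by
  unfold parityTrig
  split_ifs <;> simp

/-- The product-to-sum formulas. -/
theorem exists_parityTrig_mul (m m' : ℤ) : ∃ c d : ℝ, ∀ s t : ℝ,
    parityTrig m s * parityTrig m' t =
      c * parityTrig (m + m') (s - t) + d * parityTrig (m + m') (s + t) := by
  rcases Int.even_or_odd m with hm | hm <;> rcases Int.even_or_odd m' with hm' | hm'
  · refine ⟨1 / 2, 1 / 2, fun s t => ?_⟩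
    rw [parityTrig_even hm, parityTrig_even hm', parityTrig_even (hm.add hm'),
      parityTrig_even (hm.add hm'), Real.cos_sub, Real.cos_add]
    ring
  · refine ⟨-(1 / 2), 1 / 2, fun s t => ?_⟩
    rw [parityTrig_even hm, parityTrig_odd hm', parityTrig_odd (hm.add_odd hm'),
      parityTrig_odd (hm.add_odd hm'), Real.sin_sub, Real.sin_add]
    ring
  · refine ⟨1 / 2, 1 / 2, fun s t => ?_⟩
    rw [parityTrig_odd hm, parityTrig_even hm', parityTrig_odd (hm.add_even hm'),
      parityTrig_odd (hm.add_even hm'), Real.sin_sub, Real.sin_add]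
    ring
  · refine ⟨1 / 2, -(1 / 2), fun s t => ?_⟩
    rw [parityTrig_odd hm, parityTrig_odd hm', parityTrig_even (hm.add_odd hm'),
      parityTrig_even (hm.add_odd hm'), Real.cos_sub, Real.cos_add]
    ring

theorem wave_ext {f g : C(M.Carrier, ℂ)} (h : ∀ z, f (F.chart z) = g (F.chart z)) : f = g := by
  ext x
  obtain ⟨z, -, rfl⟩ := F.exists_chart_eq x
  exact h z

theorem exists_wave_mul (m n m' n' : ℤ) : ∃ c d : ℂ,
    F.wave m n * F.wave m' n' =
      c • F.wave (m + m') (n - n') + d • F.wave (m + m') (n + n') := by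
  obtain ⟨c, d, h⟩ := exists_parityTrig_mul m m'
  refine ⟨c, d, F.wave_ext fun z => ?_⟩
  simp only [ContinuousMap.mul_apply, ContinuousMap.add_apply, ContinuousMap.smul_apply,
    wave_chart, smul_eq_mul, planeWave]
  have h1 := h (n * (2 * Real.pi * z.2 / F.b)) (n' * (2 * Real.pi * z.2 / F.b))
  rw [← sub_mul, ← add_mul, ← Int.cast_sub, ← Int.cast_add] at h1
  have h2 := congrArg ((↑) : ℝ → ℂ) h1
  simp only [Complex.ofReal_mul, Complex.ofReal_add] at h2
  have h3 : Complex.exp ((m + m' : ℤ) * (Real.pi * z.1 / F.a : ℝ) * Complex.I) =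
      Complex.exp (m * (Real.pi * z.1 / F.a : ℝ) * Complex.I) *
        Complex.exp (m' * (Real.pi * z.1 / F.a : ℝ) * Complex.I) := by
    rw [← Complex.exp_add]
    congr 1
    push_cast
    ring
  rw [h3]
  linear_combination Complex.exp (m * (Real.pi * z.1 / F.a : ℝ) * Complex.I) *
        Complex.exp (m' * (Real.pi * z.1 / F.a : ℝ) * Complex.I) * h2

theorem conj_planeWave (m n : ℤ) (z : ℝ × ℝ) :
    conj (F.planeWave m n z) = F.planeWave (-m) n z := by
  have : parityTrig (-m) = parityTrig m := by
    funext t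
    simp only [parityTrig, even_neg]
  rw [planeWave, planeWave, map_mul, ← Complex.exp_conj, Complex.conj_ofReal, this]
  simp

theorem star_wave (m n : ℤ) : star (F.wave m n) = F.wave (-m) n :=
  F.wave_ext fun z => by
    rw [ContinuousMap.star_apply, wave_chart, wave_chart]
    exact F.conj_planeWave m n z

theorem wave_zero_zero : F.wave 0 0 = 1 :=
  F.wave_ext fun z => by
    rw [wave_chart]
    simp [planeWave, parityTrig]

/-- The trigonometric polynomials on the Klein bottle. -/
def trigPolynomials : StarSubalgebra ℂ C(M.Carrier, ℂ) where
  toSubalgebra := (Submodule.span ℂ (Set.range fun k : ℤ × ℤ => F.wave k.1 k.2)).toSubalgebra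
    (by
      rw [← F.wave_zero_zero]
      exact Submodule.subset_span ⟨(0, 0), rfl⟩)
    (by
      intro f g hf hg
      refine Submodule.span_induction₂ (p := fun f g _ _ => f * g ∈ _) ?_ ?_ ?_ ?_ ?_ ?_ ?_ hf hg
      · rintro _ _ ⟨k, rfl⟩ ⟨l, rfl⟩
        obtain ⟨c, d, h⟩ := F.exists_wave_mul k.1 k.2 l.1 l.2
        rw [h]
        exact Submodule.add_mem _ (Submodule.smul_mem _ _ (Submodule.subset_span ⟨(_, _), rfl⟩))
          (Submodule.smul_mem _ _ (Submodule.subset_span ⟨(_, _), rfl⟩))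
      · intro g _; rw [zero_mul]; exact Submodule.zero_mem _
      · intro f _; rw [mul_zero]; exact Submodule.zero_mem _
      · intro f f' g _ _ _ h h'; rw [add_mul]; exact Submodule.add_mem _ h h'
      · intro f f' g _ _ _ h h'; rw [mul_add]; exact Submodule.add_mem _ h h'
      · intro c f g _ _ h; rw [smul_mul_assoc]; exact Submodule.smul_mem _ _ h
      · intro c f g _ _ h; rw [mul_smul_comm]; exact Submodule.smul_mem _ _ h)
  star_mem' := by
    intro f hf
    refine Submodule.span_induction (p := fun f _ => star f ∈ Submodule.span ℂ
      (Set.range fun k : ℤ × ℤ => F.wave k.1 k.2)) ?_ ?_ ?_ ?_ hf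
    · rintro _ ⟨k, rfl⟩
      rw [star_wave]
      exact Submodule.subset_span ⟨(_, _), rfl⟩
    · rw [star_zero]; exact Submodule.zero_mem _
    · intro f g _ _ h h'; rw [star_add]; exact Submodule.add_mem _ h h'
    · intro c f _ h; rw [star_smul]; exact Submodule.smul_mem _ _ h

/-- The wave with indices `2, 0` determines `x` modulo `a`. After a power of the glide aligns the
first coordinates, the waves with `n = 1` and `m = 0, 1` yield cosine and sine of `2πy/b`, hence `y`
modulo `b`. -/
theorem chart_eq_of_planeWave_eq {z w : ℝ × ℝ}
    (h : ∀ m n, F.planeWave m n z = F.planeWave m n w) : F.chart z = F.chart w := by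
  have ha := F.a_pos.ne'
  have hb := F.b_pos.ne'
  obtain ⟨k, hk⟩ : ∃ k : ℤ, z.1 = w.1 + k * F.a := by
    have h1 := h 2 0
    simp only [planeWave, parityTrig_even even_two, Int.cast_zero, zero_mul, Real.cos_zero,
      Complex.ofReal_one, mul_one] at h1
    obtain ⟨k, hk⟩ := Complex.exp_eq_exp_iff_exists_int.1 h1
    refine ⟨k, ?_⟩
    have h2 : ((Real.pi * z.1 / F.a : ℝ) : ℂ) = (Real.pi * w.1 / F.a + k * Real.pi : ℝ) := by
      have h3 : (2 * Complex.I) * ((Real.pi * z.1 / F.a : ℝ) : ℂ) =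
          (2 * Complex.I) * (Real.pi * w.1 / F.a + k * Real.pi : ℝ) := by
        push_cast at hk ⊢
        linear_combination hk
      exact mul_left_cancel₀ (by simp) h3
    have h4 := Complex.ofReal_injective h2
    field_simp at h4
    linarith
  set w' : ℝ × ℝ := (w.1 + k * F.a, (-1) ^ k * w.2 + (0 : ℤ) * F.b) with hw'
  have hww' : F.chart w' = F.chart w := (F.chart_eq _ _).2 ⟨k, 0, rfl, rfl⟩
  have h' : ∀ m n, F.planeWave m n z = F.planeWave m n w' := fun m n => by
    rw [h, hw', planeWave_add]
  have hz1 : z.1 = w'.1 := hk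
  have h'' : ∀ m : ℤ, parityTrig m (2 * Real.pi * z.2 / F.b) =
      parityTrig m (2 * Real.pi * w'.2 / F.b) := by
    intro m
    have := h' m 1
    simp only [planeWave, hz1, Int.cast_one, one_mul] at this
    exact Complex.ofReal_injective (mul_left_cancel₀ (Complex.exp_ne_zero _) this)
  have hcos := h'' 0
  have hsin := h'' 1
  rw [parityTrig_even Even.zero, parityTrig_even Even.zero] at hcos
  rw [parityTrig_odd odd_one, parityTrig_odd odd_one] at hsin
  obtain ⟨l, hl⟩ := Real.Angle.angle_eq_iff_two_pi_dvd_sub.1 (Real.Angle.cos_sin_inj hcos hsin)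
  rw [← hww', chart_eq]
  refine ⟨0, l, by rw [hz1]; simp, ?_⟩
  have hpi := Real.pi_ne_zero
  field_simp at hl
  rw [zpow_zero, one_mul]
  linarith

theorem separatesPoints_trigPolynomials : F.trigPolynomials.SeparatesPoints := by
  intro x y hxy
  by_contra! hne
  apply hxy
  obtain ⟨z, -, rfl⟩ := F.exists_chart_eq x
  obtain ⟨w, -, rfl⟩ := F.exists_chart_eq y
  refine F.chart_eq_of_planeWave_eq fun m n => ?_
  rw [← wave_chart, ← wave_chart]
  exact hne _ ⟨F.wave m n, Submodule.subset_span ⟨(m, n), rfl⟩, rfl⟩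

/-- The vertical index of the `k`-th basis wave. -/
def height (k : ℤ × ℕ) : ℤ := if Even k.1 then k.2 else k.2 + 1

theorem height_nonneg (k : ℤ × ℕ) : 0 ≤ height k := by
  unfold height
  split_ifs <;> positivity

theorem height_pos_of_odd {k : ℤ × ℕ} (h : Odd k.1) : 0 < height k := by
  rw [height, if_neg (Int.not_even_iff_odd.2 h)]
  positivity

theorem height_injective {k l : ℤ × ℕ} (h1 : k.1 = l.1) (h2 : height k = height l) : k = l := by
  refine Prod.ext h1 ?_
  unfold height at h2
  rw [h1] at h2
  split_ifs at h2 <;> omega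

theorem wave_mem_span (m n : ℤ) :
    F.wave m n ∈ Submodule.span ℂ (Set.range fun k : ℤ × ℕ => F.wave k.1 (height k)) := by
  have hneg : ∀ n : ℤ, F.wave m (-n) = (if Even m then 1 else -1 : ℂ) • F.wave m n := by
    intro n
    refine F.wave_ext fun z => ?_
    rw [ContinuousMap.smul_apply, wave_chart, wave_chart, planeWave, planeWave, Int.cast_neg,
      neg_mul, parityTrig_neg]
    split_ifs <;> simp
  have hnonneg : ∀ n : ℕ, F.wave m n ∈
      Submodule.span ℂ (Set.range fun k : ℤ × ℕ => F.wave k.1 (height k)) := by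
    intro n
    rcases Int.even_or_odd m with hm | hm
    · refine Submodule.subset_span ⟨(m, n), ?_⟩
      simp [height, hm]
    -- For odd `m` the wave with `n = 0` vanishes, so `height` starts at `1` there.
    · rcases n with _ | n
      · have : F.wave m (0 : ℕ) = 0 := F.wave_ext fun z => by
          rw [wave_chart, planeWave, parityTrig_odd hm]
          simp
        rw [this]
        exact Submodule.zero_mem _
      · refine Submodule.subset_span ⟨(m, n), ?_⟩
        simp [height, Int.not_even_iff_odd.2 hm]
  obtain ⟨k, rfl | rfl⟩ := n.eq_nat_or_neg
  · exact hnonneg k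
  · rw [hneg]
    exact Submodule.smul_mem _ _ (hnonneg k)

/-- Stone–Weierstrass applies to the algebra of all waves with `n ∈ ℤ`. Changing the sign of `n`
changes a wave at most by a sign, so the waves indexed by `ℤ × ℕ` already span it. -/
theorem topologicalClosure_span_wave :
    (Submodule.span ℂ
      (Set.range fun k : ℤ × ℕ => F.wave k.1 (height k))).topologicalClosure = ⊤ := by
  have h1 := congrArg (fun A : StarSubalgebra ℂ C(M.Carrier, ℂ) => A.toSubalgebra.toSubmodule)
    (ContinuousMap.starSubalgebra_topologicalClosure_eq_top_of_separatesPoints F.trigPolynomials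
      F.separatesPoints_trigPolynomials)
  refine top_unique (le_trans (le_of_eq h1.symm) ?_)
  refine Submodule.topologicalClosure_mono (s := F.trigPolynomials.toSubalgebra.toSubmodule)
    (Submodule.span_le.2 ?_)
  rintro _ ⟨k, rfl⟩
  exact F.wave_mem_span k.1 k.2

/-! ### Orthonormality of the waves. -/

theorem integral_cos_period {b : ℝ} (hb : 0 < b) (k : ℤ) :
    ∫ y in (0 : ℝ)..b, Real.cos (k * (2 * Real.pi * y / b)) = if k = 0 then b else 0 := by
  split_ifs with hk
  · simp [hk]
  · have hc : (k * (2 * Real.pi) / b : ℝ) ≠ 0 := by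
      have := Real.pi_ne_zero
      have : (k : ℝ) ≠ 0 := by exact_mod_cast hk
      positivity
    have h1 : ∀ y, k * (2 * Real.pi * y / b) = (k * (2 * Real.pi) / b) * y := fun y => by ring
    simp only [h1]
    rw [intervalIntegral.integral_comp_mul_left (fun t => Real.cos t) hc, integral_cos,
      div_mul_cancel₀ _ hb.ne']
    have := Real.sin_int_mul_pi (k * 2)
    push_cast at this
    rw [mul_assoc] at this
    simp [this]

theorem integral_sin_period {b : ℝ} (hb : 0 < b) (k : ℤ) :
    ∫ y in (0 : ℝ)..b, Real.sin (k * (2 * Real.pi * y / b)) = 0 := by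
  rcases eq_or_ne k 0 with rfl | hk
  · simp
  · have hc : (k * (2 * Real.pi) / b : ℝ) ≠ 0 := by
      have := Real.pi_ne_zero
      have : (k : ℝ) ≠ 0 := by exact_mod_cast hk
      positivity
    have h1 : ∀ y, k * (2 * Real.pi * y / b) = (k * (2 * Real.pi) / b) * y := fun y => by ring
    simp only [h1]
    rw [intervalIntegral.integral_comp_mul_left (fun t => Real.sin t) hc, integral_sin,
      div_mul_cancel₀ _ hb.ne', Real.cos_int_mul_two_pi]
    simp

/-- Over length `a` the exponential runs through `j / 2` periods, a whole number only for even `j`.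
-/
theorem integral_exp_period {a : ℝ} (ha : 0 < a) {j : ℤ} (hj : Even j) (hj0 : j ≠ 0) :
    ∫ x in (0 : ℝ)..a, Complex.exp (j * (Real.pi * x / a : ℝ) * Complex.I) = 0 := by
  have ha' : (a : ℂ) ≠ 0 := by exact_mod_cast ha.ne'
  have hc : (j * Real.pi / a * Complex.I : ℂ) ≠ 0 := by
    have h1 : (j : ℂ) ≠ 0 := by exact_mod_cast hj0
    have h2 : (Real.pi : ℂ) ≠ 0 := by exact_mod_cast Real.pi_ne_zero
    exact mul_ne_zero (div_ne_zero (mul_ne_zero h1 h2) ha') Complex.I_ne_zero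
  have h1 : ∀ x : ℝ, (j * (Real.pi * x / a : ℝ) * Complex.I : ℂ) =
      (j * Real.pi / a * Complex.I) * x := fun x => by push_cast; ring
  simp only [h1]
  obtain ⟨i, rfl⟩ := hj
  have h2 : (((i + i : ℤ) : ℂ) * Real.pi / a * Complex.I * a : ℂ) =
      i * (2 * Real.pi * Complex.I) := by
    push_cast
    field_simp
    ring
  rw [integral_exp_mul_complex hc, h2, Complex.exp_int_mul_two_pi_mul_I]
  simp

theorem integral_cos_mul_cos {b : ℝ} (hb : 0 < b) (h h' : ℤ) :
    ∫ y in (0 : ℝ)..b, Real.cos (h * (2 * Real.pi * y / b)) *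
      Real.cos (h' * (2 * Real.pi * y / b)) =
      1 / 2 * (if h - h' = 0 then b else 0) + 1 / 2 * (if h + h' = 0 then b else 0) := by
  rw [← integral_cos_period hb, ← integral_cos_period hb, ← intervalIntegral.integral_const_mul,
    ← intervalIntegral.integral_const_mul, ← intervalIntegral.integral_add]
  · refine intervalIntegral.integral_congr fun y _ => ?_
    push_cast
    rw [sub_mul, add_mul, Real.cos_sub, Real.cos_add]
    ring
  · exact Continuous.intervalIntegrable (by fun_prop) _ _
  · exact Continuous.intervalIntegrable (by fun_prop) _ _

theorem integral_sin_mul_sin {b : ℝ} (hb : 0 < b) (h h' : ℤ) :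
    ∫ y in (0 : ℝ)..b, Real.sin (h * (2 * Real.pi * y / b)) *
      Real.sin (h' * (2 * Real.pi * y / b)) =
      1 / 2 * (if h - h' = 0 then b else 0) - 1 / 2 * (if h + h' = 0 then b else 0) := by
  rw [← integral_cos_period hb, ← integral_cos_period hb, ← intervalIntegral.integral_const_mul,
    ← intervalIntegral.integral_const_mul, ← intervalIntegral.integral_sub]
  · refine intervalIntegral.integral_congr fun y _ => ?_
    push_cast
    rw [sub_mul, add_mul, Real.cos_sub, Real.cos_add]
    ring
  · exact Continuous.intervalIntegrable (by fun_prop) _ _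
  · exact Continuous.intervalIntegrable (by fun_prop) _ _

theorem integral_sin_mul_cos {b : ℝ} (hb : 0 < b) (h h' : ℤ) :
    ∫ y in (0 : ℝ)..b, Real.sin (h * (2 * Real.pi * y / b)) *
      Real.cos (h' * (2 * Real.pi * y / b)) = 0 := by
  have h0 : 1 / 2 * (∫ y in (0 : ℝ)..b, Real.sin ((h - h' : ℤ) * (2 * Real.pi * y / b))) +
      1 / 2 * (∫ y in (0 : ℝ)..b, Real.sin ((h + h' : ℤ) * (2 * Real.pi * y / b))) = 0 := by
    rw [integral_sin_period hb, integral_sin_period hb]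
    simp
  refine Eq.trans ?_ h0
  rw [← intervalIntegral.integral_const_mul,
    ← intervalIntegral.integral_const_mul, ← intervalIntegral.integral_add]
  · refine intervalIntegral.integral_congr fun y _ => ?_
    push_cast
    rw [sub_mul, add_mul, Real.sin_sub, Real.sin_add]
    ring
  · exact Continuous.intervalIntegrable (by fun_prop) _ _
  · exact Continuous.intervalIntegrable (by fun_prop) _ _

/-- The integral of a product of two of the trigonometric functions over a period. -/
theorem integral_parityTrig_mul {b : ℝ} (hb : 0 < b) (k l : ℤ × ℕ)
    (h : k.1 = l.1 ∨ ¬ Even (k.1 - l.1)) :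
    ∫ y in (0 : ℝ)..b, parityTrig k.1 (height k * (2 * Real.pi * y / b)) *
      parityTrig l.1 (height l * (2 * Real.pi * y / b)) =
      if k = l then (if height k = 0 then b else b / 2) else 0 := by
  have hk := height_nonneg k
  have hl := height_nonneg l
  have hkl : k.1 = l.1 → (k = l ↔ height k - height l = 0) := fun h1 =>
    ⟨fun h => by rw [h, sub_self], fun h => height_injective h1 (sub_eq_zero.1 h)⟩
  rcases Int.even_or_odd k.1 with hk' | hk' <;> rcases Int.even_or_odd l.1 with hl' | hl'
  · have h1 : k.1 = l.1 := h.resolve_right (fun h => h (hk'.sub hl'))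
    simp only [parityTrig_even hk', parityTrig_even hl', integral_cos_mul_cos hb, hkl h1]
    split_ifs <;> first | omega | ring
  · have hne : k ≠ l := by
      rintro rfl
      exact Int.not_even_iff_odd.2 hl' hk'
    simp only [parityTrig_even hk', parityTrig_odd hl', if_neg hne]
    refine Eq.trans ?_ (integral_sin_mul_cos hb (height l) (height k))
    exact intervalIntegral.integral_congr fun y _ => mul_comm (Real.cos _) (Real.sin _)
  · have hne : k ≠ l := by
      rintro rfl
      exact Int.not_even_iff_odd.2 hk' hl'
    simp only [parityTrig_odd hk', parityTrig_even hl', if_neg hne, integral_sin_mul_cos hb]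
  · have h1 : k.1 = l.1 := h.resolve_right (fun h => h (hk'.sub_odd hl'))
    have hk0 := height_pos_of_odd hk'
    simp only [parityTrig_odd hk', parityTrig_odd hl', integral_sin_mul_sin hb, hkl h1]
    split_ifs <;> first | omega | ring

theorem integral_domain (f g : ℝ → ℂ) :
    ∫ z in F.domain, f z.1 * g z.2 =
      (∫ x in (0 : ℝ)..F.a, f x) * ∫ y in (0 : ℝ)..F.b, g y := by
  rw [intervalIntegral.integral_of_le F.a_pos.le, intervalIntegral.integral_of_le F.b_pos.le]
  exact setIntegral_prod_mul f g _ _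

theorem inner_wave (k l : ℤ × ℕ) :
    ∫ x, F.wave l.1 (height l) x * conj (F.wave k.1 (height k) x) ∂M.area =
      if k = l then ((if height k = 0 then F.a * F.b else F.a * F.b / 2 : ℝ) : ℂ) else 0 := by
  rw [F.integral_area (fun x => F.wave l.1 (height l) x * conj (F.wave k.1 (height k) x))
    (by fun_prop)]
  have h1 : ∀ z : ℝ × ℝ, F.wave l.1 (height l) (F.chart z) *
      conj (F.wave k.1 (height k) (F.chart z)) =
      Complex.exp ((l.1 - k.1 : ℤ) * (Real.pi * z.1 / F.a : ℝ) * Complex.I) *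
      ((parityTrig k.1 (height k * (2 * Real.pi * z.2 / F.b)) *
        parityTrig l.1 (height l * (2 * Real.pi * z.2 / F.b)) : ℝ) : ℂ) := by
    intro z
    have h3 : Complex.exp ((l.1 - k.1 : ℤ) * (Real.pi * z.1 / F.a : ℝ) * Complex.I) =
        Complex.exp (l.1 * (Real.pi * z.1 / F.a : ℝ) * Complex.I) *
          Complex.exp ((-k.1 : ℤ) * (Real.pi * z.1 / F.a : ℝ) * Complex.I) := by
      rw [← Complex.exp_add]
      congr 1
      push_cast
      ring
    have h4 : parityTrig (-k.1) = parityTrig k.1 := by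
      funext t
      simp only [parityTrig, even_neg]
    rw [wave_chart, wave_chart, conj_planeWave, planeWave, planeWave, h3, h4]
    push_cast
    ring
  simp only [h1]
  rw [F.integral_domain (fun x => Complex.exp ((l.1 - k.1 : ℤ) * (Real.pi * x / F.a : ℝ) *
    Complex.I)) (fun y => ((parityTrig k.1 (height k * (2 * Real.pi * y / F.b)) *
        parityTrig l.1 (height l * (2 * Real.pi * y / F.b)) : ℝ) : ℂ)),
    intervalIntegral.integral_ofReal]
  -- For an even nonzero difference of horizontal indices the exponential integrates to zero. For an
  -- odd difference it need not, and orthogonality comes instead from pairing a sine with a cosine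
  -- over a full vertical period.
  by_cases h : k.1 = l.1 ∨ ¬ Even (k.1 - l.1)
  · rw [integral_parityTrig_mul F.b_pos k l h]
    by_cases hkl : k = l
    · subst hkl
      simp only [sub_self, Int.cast_zero, zero_mul, Complex.exp_zero, if_true]
      rw [intervalIntegral.integral_const]
      split_ifs
      · simp
      · simp; ring
    · simp [hkl]
  · push Not at h
    have hkl : k ≠ l := fun hkl => h.1 (congrArg Prod.fst hkl)
    rw [integral_exp_period F.a_pos (by rw [← even_neg, neg_sub]; exact h.2)
      (sub_ne_zero.2 (Ne.symm h.1)), zero_mul, if_neg hkl]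

/-- The square of the factor that normalizes the `k`-th wave. -/
def weight (k : ℤ × ℕ) : ℝ := if height k = 0 then 1 / (F.a * F.b) else 2 / (F.a * F.b)

theorem weight_pos (k : ℤ × ℕ) : 0 < F.weight k := by
  have := F.a_pos
  have := F.b_pos
  unfold weight
  split_ifs <;> positivity

/-- The normalized waves. -/
def basisWave (k : ℤ × ℕ) : C(M.Carrier, ℂ) := ((√(F.weight k) : ℝ) : ℂ) • F.wave k.1 (height k)

theorem isEigenfunction_basisWave (k : ℤ × ℕ) :
    M.IsEigenfunction (F.basisWave k) (F.waveFreq k.1 (height k)) :=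
  (F.isEigenfunction_wave k.1 (height k)).const_mul _

theorem orthonormal_basisWave :
    Orthonormal ℂ (fun k => ContinuousMap.toLp (E := ℂ) 2 M.area ℂ (F.basisWave k)) := by
  have ha := F.a_pos.ne'
  have hb := F.b_pos.ne'
  rw [orthonormal_iff_ite]
  intro k l
  have h : ContinuousMap.toLp (E := ℂ) 2 M.area ℂ (F.basisWave k) =
      ((√(F.weight k) : ℝ) : ℂ) • ContinuousMap.toLp (E := ℂ) 2 M.area ℂ (F.wave k.1 (height k)) :=
    map_smul _ _ _
  have h' : ContinuousMap.toLp (E := ℂ) 2 M.area ℂ (F.basisWave l) =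
      ((√(F.weight l) : ℝ) : ℂ) • ContinuousMap.toLp (E := ℂ) 2 M.area ℂ (F.wave l.1 (height l)) :=
    map_smul _ _ _
  rw [h, h', inner_smul_left, inner_smul_right, ContinuousMap.inner_toLp, inner_wave,
    Complex.conj_ofReal]
  split_ifs with hkl h0
  · subst hkl
    rw [← mul_assoc, ← Complex.ofReal_mul, Real.mul_self_sqrt (F.weight_pos _).le, weight, if_pos h0,
      ← Complex.ofReal_mul]
    norm_cast
    field_simp
  · subst hkl
    rw [← mul_assoc, ← Complex.ofReal_mul, Real.mul_self_sqrt (F.weight_pos _).le, weight, if_neg h0,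
      ← Complex.ofReal_mul]
    norm_cast
    field_simp
  · simp

/-- Uniform density passes to `L²` because continuous functions are dense there; nonzero normalizing
factors do not affect the span. -/
theorem topologicalClosure_span_basisWave :
    (Submodule.span ℂ (Set.range fun k => ContinuousMap.toLp (E := ℂ) 2 M.area ℂ
      (F.basisWave k))).topologicalClosure = ⊤ := by
  have h1 := (ContinuousMap.toLp_denseRange ℂ M.area ℂ
    (p := 2) (by norm_num)).topologicalClosure_map_submodule F.topologicalClosure_span_wave
  refine top_unique (le_trans (le_of_eq h1.symm) (Submodule.topologicalClosure_mono ?_))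
  rw [Submodule.map_span, Submodule.span_le]
  rintro _ ⟨_, ⟨k, rfl⟩, rfl⟩
  have hw : F.wave k.1 (height k) = ((√(F.weight k) : ℝ) : ℂ)⁻¹ • F.basisWave k := by
    rw [basisWave, inv_smul_smul₀]
    exact_mod_cast (Real.sqrt_pos.2 (F.weight_pos k)).ne'
  change ContinuousMap.toLp (E := ℂ) 2 M.area ℂ (F.wave k.1 (height k)) ∈ _
  rw [hw, map_smul]
  exact Submodule.smul_mem _ _ (Submodule.subset_span ⟨k, rfl⟩)

/-- The orthonormal basis of normalized waves. -/
def waveBasis : HilbertBasis (ℤ × ℕ) ℂ (Lp ℂ 2 M.area) :=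
  HilbertBasis.mk F.orthonormal_basisWave F.topologicalClosure_span_basisWave.ge

theorem waveBasis_apply (k : ℤ × ℕ) :
    F.waveBasis k = ContinuousMap.toLp (E := ℂ) 2 M.area ℂ (F.basisWave k) := by
  rw [waveBasis, HilbertBasis.coe_mk]

end Frame

theorem nonempty_eigenbasis (M : FlatKleinBottle) : Nonempty M.Eigenbasis := by
  let F := M.nonempty_frame.some
  obtain ⟨e⟩ : Nonempty (ℕ ≃ ℤ × ℕ) := nonempty_equiv_of_countable
  have hon := F.orthonormal_basisWave.comp e e.injective
  have hsp : ⊤ ≤ (Submodule.span ℂ (Set.range ((fun k => ContinuousMap.toLp (E := ℂ) 2 M.area ℂ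
      (F.basisWave k)) ∘ e))).topologicalClosure := by
    rw [e.surjective.range_comp]
    exact F.topologicalClosure_span_basisWave.ge
  refine ⟨{
    basis := HilbertBasis.mk hon hsp
    e := fun j => F.basisWave (e j)
    freq := fun j => F.waveFreq (e j).1 (Frame.height (e j))
    ae_eq := fun j => ?_
    isEigenfunction := fun j => F.isEigenfunction_basisWave (e j)
    freq_nonneg := fun j => Real.sqrt_nonneg _ }⟩
  rw [HilbertBasis.coe_mk]
  exact ContinuousMap.coeFn_toLp M.area (F.basisWave (e j))

theorem IsEigenfunction.conj {f : M.Carrier → ℂ} {lam : ℝ} (h : M.IsEigenfunction f lam) :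
    M.IsEigenfunction (fun x => conj (f x)) lam where
  smooth := Complex.conjCLE.contDiff.comp h.smooth
  laplacian_eq p := by
    have h1 : (fun x => conj (f x)) ∘ M.proj = Complex.conjCLE ∘ (f ∘ M.proj) := rfl
    rw [h1, laplacian_CLE_comp_left]
    simp [h.laplacian_eq]

theorem IsEigenfunction.contDiff_comp_chart {f : M.Carrier → ℂ} {lam : ℝ}
    (h : M.IsEigenfunction f lam) (F : M.Frame) : ContDiff ℝ 2 (f ∘ F.chart) :=
  (h.smooth.of_le (WithTop.coe_le_coe.2 le_top)).comp F.contDiff_toPlane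

theorem IsEigenfunction.laplacian_comp_chart {f : M.Carrier → ℂ} {lam : ℝ}
    (h : M.IsEigenfunction f lam) (F : M.Frame) (z : ℝ × ℝ) :
    fderiv ℝ (fun z => fderiv ℝ (f ∘ F.chart) z (1, 0)) z (1, 0) +
      fderiv ℝ (fun z => fderiv ℝ (f ∘ F.chart) z (0, 1)) z (0, 1) =
      -((lam : ℂ) ^ 2) * f (F.chart z) := by
  have h1 := F.laplacian_toPlane (h.smooth.of_le (WithTop.coe_le_coe.2 le_top)) z
  rw [h.laplacian_eq] at h1
  exact h1.symm

/-! ### Green's identity and orthogonality of eigenfunctions. -/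

/-- The component in direction `e` of the vector field `v ∇u - u ∇v`. -/
def greenField (u v : ℝ × ℝ → ℂ) (e z : ℝ × ℝ) : ℂ :=
  v z * fderiv ℝ u z e - fderiv ℝ v z e * u z

theorem contDiff_fderiv_apply {u : ℝ × ℝ → ℂ} (hu : ContDiff ℝ 2 u) (e : ℝ × ℝ) :
    ContDiff ℝ 1 (fun z => fderiv ℝ u z e) :=
  (hu.fderiv_right (m := 1) (by norm_num)).clm_apply contDiff_const

theorem contDiff_greenField {u v : ℝ × ℝ → ℂ} (hu : ContDiff ℝ 2 u) (hv : ContDiff ℝ 2 v)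
    (e : ℝ × ℝ) : ContDiff ℝ 1 (greenField u v e) :=
  ((hv.of_le (by norm_num)).mul (contDiff_fderiv_apply hu e)).sub
    ((contDiff_fderiv_apply hv e).mul (hu.of_le (by norm_num)))

theorem fderiv_greenField {u v : ℝ × ℝ → ℂ} (hu : ContDiff ℝ 2 u) (hv : ContDiff ℝ 2 v)
    (e z : ℝ × ℝ) : fderiv ℝ (greenField u v e) z e =
      v z * fderiv ℝ (fun z => fderiv ℝ u z e) z e -
        fderiv ℝ (fun z => fderiv ℝ v z e) z e * u z := by
  have hu1 := (hu.differentiable two_ne_zero z).hasFDerivAt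
  have hv1 := (hv.differentiable two_ne_zero z).hasFDerivAt
  have hu2 := ((contDiff_fderiv_apply hu e).differentiable one_ne_zero z).hasFDerivAt
  have hv2 := ((contDiff_fderiv_apply hv e).differentiable one_ne_zero z).hasFDerivAt
  have h := (hv1.mul hu2).sub (hv2.mul hu1)
  have h' : fderiv ℝ (greenField u v e) z = _ := h.fderiv
  rw [h']
  simp
  ring

/-- By the chain rule, a symmetry shared by `u` and `v` carries over to derivatives in a direction
fixed by its linear part. It is used with `L` the identity for the vertical period, and with `L` the
reflection and `e = (1, 0)` for the glide. -/
theorem greenField_comp_linear {u v : ℝ × ℝ → ℂ} (hu : ContDiff ℝ 2 u) (hv : ContDiff ℝ 2 v)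
    {c e : ℝ × ℝ} (L : ℝ × ℝ →L[ℝ] ℝ × ℝ) (hL : L e = e) (hcu : ∀ z, u (z + c) = u (L z))
    (hcv : ∀ z, v (z + c) = v (L z)) (z : ℝ × ℝ) :
    greenField u v e (z + c) = greenField u v e (L z) := by
  have key : ∀ f : ℝ × ℝ → ℂ, ContDiff ℝ 2 f → (∀ z, f (z + c) = f (L z)) →
      fderiv ℝ f (z + c) e = fderiv ℝ f (L z) e := by
    intro f hf hc
    have h1 := (hf.differentiable two_ne_zero (L z)).hasFDerivAt.comp z L.hasFDerivAt
    rw [← fderiv_comp_add_right, show (fun z => f (z + c)) = f ∘ L from funext hc, h1.fderiv,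
      ContinuousLinearMap.comp_apply, hL]
  rw [greenField, greenField, key u hu hcu, key v hv hcv, hcu, hcv]

theorem Frame.chart_add_glide (F : M.Frame) (z : ℝ × ℝ) :
    F.chart (z + (F.a, 0)) = F.chart (z.1, -z.2) :=
  (F.chart_eq _ _).2 ⟨1, 0, by simp, by simp⟩

theorem Frame.chart_add_period (F : M.Frame) (z : ℝ × ℝ) : F.chart (z + (0, F.b)) = F.chart z :=
  (F.chart_eq _ _).2 ⟨0, 1, by simp, by simp⟩

/-- Green's identity on the Klein bottle. -/
theorem integral_mul_eigenfunction {f g : M.Carrier → ℂ} {lam mu : ℝ}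
    (hf : M.IsEigenfunction f lam) (hg : M.IsEigenfunction g mu) (hne : lam ^ 2 ≠ mu ^ 2) :
    ∫ x, f x * g x ∂M.area = 0 := by
  let F := M.nonempty_frame.some
  set u := f ∘ F.chart with hu'
  set v := g ∘ F.chart with hv'
  have hu : ContDiff ℝ 2 u := hf.contDiff_comp_chart F
  have hv : ContDiff ℝ 2 v := hg.contDiff_comp_chart F
  have hdiv : ∀ z, fderiv ℝ (greenField u v (1, 0)) z (1, 0) +
      fderiv ℝ (greenField u v (0, 1)) z (0, 1) =
      ((mu : ℂ) ^ 2 - (lam : ℂ) ^ 2) * (u z * v z) := by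
    intro z
    have h1 := hf.laplacian_comp_chart F z
    have h2 := hg.laplacian_comp_chart F z
    rw [fderiv_greenField hu hv, fderiv_greenField hu hv]
    change _ = ((mu : ℂ) ^ 2 - (lam : ℂ) ^ 2) * (f (F.chart z) * g (F.chart z))
    change g (F.chart z) * _ - _ * f (F.chart z) +
      (g (F.chart z) * _ - _ * f (F.chart z)) = _
    linear_combination g (F.chart z) * h1 - f (F.chart z) * h2
  have hcont : Continuous fun z => u z * v z := hu.continuous.mul hv.continuous
  have hint : ∀ s : Set (ℝ × ℝ), s ⊆ Set.Icc 0 F.a ×ˢ Set.Icc 0 F.b →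
      IntegrableOn (fun z => u z * v z) s := fun s hs =>
    (hcont.continuousOn.integrableOn_compact (isCompact_Icc.prod isCompact_Icc)).mono_set hs
  have hgreen := integral2_divergence_prod_of_hasFDerivAt_off_countable
    (greenField u v (1, 0)) (greenField u v (0, 1))
    (fderiv ℝ (greenField u v (1, 0))) (fderiv ℝ (greenField u v (0, 1))) 0 0 F.a F.b ∅
    Set.countable_empty (contDiff_greenField hu hv _).continuous.continuousOn
    (contDiff_greenField hu hv _).continuous.continuousOn
    (fun z _ => ((contDiff_greenField hu hv _).differentiable one_ne_zero z).hasFDerivAt)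
    (fun z _ => ((contDiff_greenField hu hv _).differentiable one_ne_zero z).hasFDerivAt)
    (by
      simp only [hdiv]
      refine (hint _ ?_).const_mul _
      rw [Set.uIcc_of_le F.a_pos.le, Set.uIcc_of_le F.b_pos.le])
  have hy : ∀ e : ℝ × ℝ, ∀ z, greenField u v e (z + (0, F.b)) = greenField u v e z := by
    intro e z
    exact greenField_comp_linear hu hv (ContinuousLinearMap.id ℝ _) rfl
      (fun z => congrArg f (F.chart_add_period z)) (fun z => congrArg g (F.chart_add_period z)) z
  have hx : ∀ z, greenField u v (1, 0) (z + (F.a, 0)) = greenField u v (1, 0) (z.1, -z.2) := by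
    intro z
    exact greenField_comp_linear hu hv
      ((ContinuousLinearMap.fst ℝ ℝ ℝ).prod (-ContinuousLinearMap.snd ℝ ℝ ℝ)) (by simp)
      (fun z => congrArg f (F.chart_add_glide z)) (fun z => congrArg g (F.chart_add_glide z)) z
  have hb1 : ∀ x : ℝ, greenField u v (0, 1) (x, F.b) = greenField u v (0, 1) (x, 0) := by
    intro x
    simpa using hy (0, 1) (x, 0)
  have hb2 : ∀ y : ℝ, greenField u v (1, 0) (F.a, y) = greenField u v (1, 0) (0, -y) := by
    intro y
    simpa using hx (0, y)
  have hper : Function.Periodic (fun y : ℝ => greenField u v (1, 0) (0, y)) F.b := by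
    intro y
    simpa using hy (1, 0) (0, y)
  -- The glide identifies the right edge with the left edge turned upside down. The flux is
  -- `b`-periodic in `y`, so its integral over a period is unaffected by `y ↦ -y`, and the vertical
  -- edges cancel.
  have hb3 : ∫ y in (0 : ℝ)..F.b, greenField u v (1, 0) (F.a, y) =
      ∫ y in (0 : ℝ)..F.b, greenField u v (1, 0) (0, y) := by
    simp only [hb2]
    rw [intervalIntegral.integral_comp_neg (fun y => greenField u v (1, 0) (0, y))]
    have := hper.intervalIntegral_add_eq (-F.b) 0
    simpa using this
  simp only [hdiv, hb1, hb3, sub_self, zero_add, intervalIntegral.integral_const_mul] at hgreen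
  have hne' : ((mu : ℂ) ^ 2 - (lam : ℂ) ^ 2) ≠ 0 := by
    rw [sub_ne_zero]
    exact_mod_cast hne.symm
  have h0 := (mul_eq_zero.1 hgreen).resolve_left hne'
  rw [F.integral_area (fun x => f x * g x) (hf.continuous.mul hg.continuous), Frame.domain,
    Measure.volume_eq_prod, setIntegral_prod]
  · rw [intervalIntegral.integral_of_le F.a_pos.le] at h0
    simp only [intervalIntegral.integral_of_le F.b_pos.le] at h0
    exact h0
  · exact hint _ (Set.prod_mono Set.Ioc_subset_Icc_self Set.Ioc_subset_Icc_self)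

/-! ### Isometries of the Klein bottle. -/

/-- An isometry of the plane that respects the fibres of the covering descends. -/
theorem exists_isometry_of_forall_proj_eq_iff (S : PlaneIsometry)
    (hS : ∀ p q, M.proj (S p) = M.proj (S q) ↔ M.proj p = M.proj q) :
    ∃ Φ : M.Carrier ≃ᵢ M.Carrier, ∀ p, Φ (M.proj p) = M.proj (S p) := by
  let f : M.Carrier → M.Carrier := fun x => M.proj (S (Function.surjInv M.proj_surjective x))
  have hf : ∀ p, f (M.proj p) = M.proj (S p) := fun p =>
    (hS _ _).2 (Function.surjInv_eq M.proj_surjective (M.proj p))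
  have hpre : ∀ p, M.proj ⁻¹' {M.proj (S p)} = S '' (M.proj ⁻¹' {M.proj p}) := by
    intro p
    ext q
    constructor
    · intro hq
      refine ⟨S.symm q, ?_, S.apply_symm_apply q⟩
      refine (hS _ _).1 ?_
      rw [S.apply_symm_apply]
      exact hq
    · rintro ⟨q, hq, rfl⟩
      exact (hS _ _).2 hq
  have hiso : Isometry f := by
    refine Isometry.of_dist_eq fun x y => ?_
    obtain ⟨p, rfl⟩ := M.proj_surjective x
    obtain ⟨q, rfl⟩ := M.proj_surjective y
    rw [hf, hf, dist_def, dist_def, hpre, hpre, Set.image2_image_left, Set.image2_image_right]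
    simp only [S.dist_map]
  have hsurj : Function.Surjective f := by
    intro y
    obtain ⟨q, rfl⟩ := M.proj_surjective y
    exact ⟨M.proj (S.symm q), by rw [hf, S.apply_symm_apply]⟩
  exact ⟨⟨Equiv.ofBijective f ⟨hiso.injective, hsurj⟩, hiso⟩, hf⟩

/-- A translation descends if it normalizes the deck group. The reflection in a glide reverses a
vertical shift `s`, so commuting the two costs a vertical shift by `2s`, which lies in `bℤ` for `s =
j b / 2`. The horizontal shift is unrestricted. -/
theorem Frame.exists_isometry_chart (F : M.Frame) (t : ℝ) (j : ℤ) :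
    ∃ Φ : M.Carrier ≃ᵢ M.Carrier, ∀ z,
      Φ (F.chart z) = F.chart (z.1 + t, z.2 + j * F.b / 2) := by
  let S : PlaneIsometry := (F.A.trans (AffineIsometryEquiv.constVAdd ℝ ℂ ⟨t, j * F.b / 2⟩)).trans
    F.A.symm
  have hA : ∀ p, F.A (S p) = ⟨t, j * F.b / 2⟩ + F.A p := fun p => F.A.apply_symm_apply _
  obtain ⟨Φ, hΦ⟩ := exists_isometry_of_forall_proj_eq_iff (M := M) S (by
    intro p q
    rw [F.proj_eq, F.proj_eq, hA, hA]
    simp only [Complex.add_re, Complex.add_im]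
    constructor
    · rintro ⟨k, l, h1, h2⟩
      rcases Int.even_or_odd k with hk | hk
      · rw [hk.neg_one_zpow] at h2
        refine ⟨k, l, by linarith, ?_⟩
        rw [hk.neg_one_zpow]
        linarith
      · rw [hk.neg_one_zpow] at h2
        refine ⟨k, l - j, by linarith, ?_⟩
        rw [hk.neg_one_zpow]
        push_cast
        linarith
    · rintro ⟨k, l, h1, h2⟩
      rcases Int.even_or_odd k with hk | hk
      · rw [hk.neg_one_zpow] at h2
        refine ⟨k, l, by linarith, ?_⟩
        rw [hk.neg_one_zpow]
        linarith
      · rw [hk.neg_one_zpow] at h2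
        refine ⟨k, l + j, by linarith, ?_⟩
        rw [hk.neg_one_zpow]
        push_cast
        linarith)
  refine ⟨Φ, fun z => ?_⟩
  rw [Frame.chart, hΦ, Frame.chart]
  congr 1
  apply F.A.injective
  rw [hA, F.A_toPlane, F.A_toPlane]
  apply Complex.ext <;> simp [add_comm]

namespace Frame

variable (F : M.Frame)

/-! ### Independence of the counting function from the eigenbasis. -/

theorem toLp_injective : Function.Injective (ContinuousMap.toLp (E := ℂ) 2 M.area ℂ) := by
  intro f g h
  have h1 : (f : M.Carrier → ℂ) =ᵐ[M.area] g :=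
    (ContinuousMap.coeFn_toLp M.area f).symm.trans
      ((Lp.ext_iff.1 h).trans (ContinuousMap.coeFn_toLp M.area g))
  exact ContinuousMap.coe_injective
    (M.nonempty_frame.some.eq_of_ae_eq f.continuous g.continuous h1)

theorem abs_le_of_waveFreq_le {m n : ℤ} {lam : ℝ} (h : F.waveFreq m n ≤ lam) :
    |m * Real.pi / F.a| ≤ lam ∧ |n * (2 * Real.pi) / F.b| ≤ lam := by
  constructor
  · refine (Real.abs_le_sqrt ?_).trans h
    have := sq_nonneg (n * (2 * Real.pi) / F.b)
    linarith
  · refine (Real.abs_le_sqrt ?_).trans h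
    have := sq_nonneg (m * Real.pi / F.a)
    linarith

theorem finite_waveFreq_le (lam : ℝ) :
    {k : ℤ × ℕ | F.waveFreq k.1 (height k) ≤ lam}.Finite := by
  have ha := F.a_pos
  have hb := F.b_pos
  have hpi := Real.pi_pos
  refine ((Set.finite_Icc (-⌈lam * F.a / Real.pi⌉) ⌈lam * F.a / Real.pi⌉).prod
    (Set.finite_Iic ⌈lam * F.b / (2 * Real.pi)⌉₊)).subset ?_
  rintro k hk
  obtain ⟨h1, h2⟩ := F.abs_le_of_waveFreq_le hk
  constructor
  · rw [abs_div, abs_mul, abs_of_pos hpi, abs_of_pos ha, div_le_iff₀ ha, ← le_div_iff₀ hpi] at h1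
    have h3 : |k.1| ≤ ⌈lam * F.a / Real.pi⌉ := by
      have := h1.trans (Int.le_ceil _)
      exact_mod_cast this
    exact abs_le.1 h3
  · have h3 := (le_abs_self _).trans h2
    rw [div_le_iff₀ hb, ← le_div_iff₀ (by positivity)] at h3
    have h4 : ((k.2 : ℤ) : ℝ) ≤ height k := by
      have : (k.2 : ℤ) ≤ height k := by unfold height; split_ifs <;> omega
      exact_mod_cast this
    have h5 : (k.2 : ℝ) ≤ ⌈lam * F.b / (2 * Real.pi)⌉₊ := by
      have := (h4.trans h3).trans (Nat.le_ceil _)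
      exact_mod_cast this
    exact_mod_cast h5

end Frame

namespace Eigenbasis

variable (B : M.Eigenbasis)

/-- The elements of an eigenbasis as continuous functions. -/
def toContinuousMap (j : ℕ) : C(M.Carrier, ℂ) := ⟨B.e j, (B.isEigenfunction j).continuous⟩

theorem basis_eq (j : ℕ) :
    B.basis j = ContinuousMap.toLp (E := ℂ) 2 M.area ℂ (B.toContinuousMap j) :=
  Lp.ext ((B.ae_eq j).trans (ContinuousMap.coeFn_toLp M.area (B.toContinuousMap j)).symm)

/-- Green's identity is bilinear, so it is applied to the conjugate of the wave, again an
eigenfunction. Nonnegativity turns different frequencies into different eigenvalues. -/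
theorem inner_waveBasis_eq_zero (F : M.Frame) {k : ℤ × ℕ} {j : ℕ}
    (h : F.waveFreq k.1 (Frame.height k) ≠ B.freq j) :
    inner ℂ (F.waveBasis k) (B.basis j) = 0 := by
  rw [F.waveBasis_apply, basis_eq, ContinuousMap.inner_toLp]
  refine integral_mul_eigenfunction (B.isEigenfunction j) (F.isEigenfunction_basisWave k).conj ?_
  have hnonneg : 0 ≤ F.waveFreq k.1 (Frame.height k) := Real.sqrt_nonneg _
  rw [Ne, sq_eq_sq₀ (B.freq_nonneg j) hnonneg]
  exact Ne.symm h

/-- Only waves of the same frequency as the `j`-th eigenfunction contribute to its expansion, so the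
expansion is finite. Both sides are continuous, and the identity in `L²` therefore holds at every
point `x`. -/
theorem sum_inner_mul_basisWave (F : M.Frame) (lam : ℝ) (x : M.Carrier) (j : ℕ) :
    ∑ k ∈ (F.finite_waveFreq_le lam).toFinset,
      inner ℂ (F.waveBasis k) (B.basis j) * F.basisWave k x =
      if B.freq j ≤ lam then B.e j x else 0 := by
  split_ifs with hj
  · have h1 : ∀ k ∉ (F.finite_waveFreq_le lam).toFinset,
        F.waveBasis.repr (B.basis j) k • F.waveBasis k = 0 := by
      intro k hk
      rw [HilbertBasis.repr_apply_apply, B.inner_waveBasis_eq_zero, zero_smul]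
      intro h
      exact hk (by simpa [h] using hj)
    have h2 := (F.waveBasis.hasSum_repr (B.basis j)).unique (hasSum_sum_of_ne_finset_zero h1)
    have h3 : B.toContinuousMap j = ∑ k ∈ (F.finite_waveFreq_le lam).toFinset,
        inner ℂ (F.waveBasis k) (B.basis j) • F.basisWave k := by
      apply Frame.toLp_injective
      rw [← basis_eq, map_sum]
      refine h2.trans ?_
      refine Finset.sum_congr rfl fun k _ => ?_
      rw [map_smul, HilbertBasis.repr_apply_apply, ← F.waveBasis_apply]
    have h4 := congrArg (fun f : C(M.Carrier, ℂ) => f x) h3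
    simp only [ContinuousMap.sum_apply, ContinuousMap.smul_apply, smul_eq_mul] at h4
    exact h4.symm
  · refine Finset.sum_eq_zero fun k hk => ?_
    rw [B.inner_waveBasis_eq_zero, zero_mul]
    intro h
    rw [Set.Finite.mem_toFinset, Set.mem_ofPred_eq, h] at hk
    exact hj hk

end Eigenbasis

/-- The pointwise Weyl counting function does not depend on the eigenbasis. -/
theorem weylCount_eq (B : M.Eigenbasis) (F : M.Frame) (lam : ℝ) (x : M.Carrier) :
    weylCount B x lam = ENNReal.ofReal
      (∑ k ∈ (F.finite_waveFreq_le lam).toFinset, ‖F.basisWave k x‖ ^ 2) := by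
  set S := (F.finite_waveFreq_le lam).toFinset with hS
  -- `K` represents the functional sending `f` to the value at `x` of its projection to frequencies
  -- at most `lam`. Its squared norm is computed by Parseval in both bases.
  set K : Lp ℂ 2 M.area := ∑ k ∈ S, conj (F.basisWave k x) • F.waveBasis k with hK
  have hKb : ∀ j, inner ℂ K (B.basis j) = if B.freq j ≤ lam then B.e j x else 0 := by
    intro j
    rw [← B.sum_inner_mul_basisWave F lam x j, hK, sum_inner]
    refine Finset.sum_congr rfl fun k _ => ?_
    rw [inner_smul_left, Complex.conj_conj, mul_comm]
  have hKK : inner ℂ K K = ((∑ k ∈ S, ‖F.basisWave k x‖ ^ 2 : ℝ) : ℂ) := by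
    rw [hK, F.waveBasis.orthonormal.inner_sum, Complex.ofReal_sum]
    refine Finset.sum_congr rfl fun k _ => ?_
    rw [Complex.conj_conj, Complex.mul_conj, Complex.normSq_eq_norm_sq]
  have hsum : HasSum (fun j => if B.freq j ≤ lam then ‖B.e j x‖ ^ 2 else 0)
      (∑ k ∈ S, ‖F.basisWave k x‖ ^ 2) := by
    have h1 := B.basis.hasSum_inner_mul_inner K K
    rw [hKK] at h1
    rw [← Complex.hasSum_ofReal]
    refine h1.congr_fun ?_
    intro j
    rw [← inner_conj_symm (B.basis j) K, hKb]
    split_ifs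
    · rw [Complex.mul_conj, Complex.normSq_eq_norm_sq]
    · simp
  rw [← hsum.tsum_eq, ENNReal.ofReal_tsum_of_nonneg _ hsum.summable, weylCount]
  · refine (tsum_subtype {j | B.freq j ≤ lam} (fun j => ‖B.e j x‖ₑ ^ 2)).trans ?_
    refine tsum_congr fun j => ?_
    rw [Set.indicator_apply]
    simp only [Set.mem_ofPred_eq]
    split_ifs
    · rw [ENNReal.ofReal_pow (norm_nonneg _), ofReal_norm]
    · simp
  · intro j
    split_ifs <;> positivity

namespace Frame

variable (F : M.Frame)

/-! ### The counting function at frequency `2π/b`. -/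

theorem norm_basisWave_chart_sq (k : ℤ × ℕ) (z : ℝ × ℝ) :
    ‖F.basisWave k (F.chart z)‖ ^ 2 =
      F.weight k * parityTrig k.1 (height k * (2 * Real.pi * z.2 / F.b)) ^ 2 := by
  have h : F.basisWave k (F.chart z) = (√(F.weight k) : ℝ) * F.planeWave k.1 (height k) z := by
    rw [← F.wave_chart]
    rfl
  have h2 : (k.1 * (Real.pi * z.1 / F.a : ℝ) * Complex.I : ℂ) =
      (k.1 * (Real.pi * z.1 / F.a) : ℝ) * Complex.I := by push_cast; ring
  rw [h, planeWave, norm_mul, norm_mul, h2, Complex.norm_exp_ofReal_mul_I, one_mul,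
    Complex.norm_real, Complex.norm_real, mul_pow, Real.norm_eq_abs, Real.norm_eq_abs, sq_abs,
    sq_abs, Real.sq_sqrt (F.weight_pos k).le]

theorem waveFreq_zero_one : F.waveFreq 0 1 = 2 * Real.pi / F.b := by
  have := F.b_pos
  have := Real.pi_pos
  rw [waveFreq]
  simp only [Int.cast_zero, zero_mul, zero_div, Int.cast_one, one_mul]
  rw [zero_pow two_ne_zero, zero_add, Real.sqrt_sq (by positivity)]

theorem height_zero_one : height (0, 1) = 1 := by simp [height]

/-- Up to the lowest frequency of a wave that depends on the vertical coordinate, there is only one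
such wave. -/
theorem height_eq_zero_of_waveFreq_le {k : ℤ × ℕ}
    (h : F.waveFreq k.1 (height k) ≤ 2 * Real.pi / F.b) (hk : k ≠ (0, 1)) : height k = 0 := by
  have ha := F.a_pos
  have hb := F.b_pos
  have hpi := Real.pi_pos
  by_contra h0
  have h1 : 1 ≤ height k := by have := height_nonneg k; omega
  have hle : height k ≤ 1 := by
    have h2 := (le_abs_self _).trans (F.abs_le_of_waveFreq_le h).2
    rw [div_le_div_iff_of_pos_right hb] at h2
    have h3 : (height k : ℝ) ≤ 1 := by nlinarith
    exact_mod_cast h3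
  have hheight : height k = 1 := le_antisymm hle h1
  -- Vertical index `1` alone exhausts the bound `2π/b`, leaving no room for a nonzero horizontal
  -- index.
  rw [hheight, waveFreq, Real.sqrt_le_left (by positivity)] at h
  have hm : (k.1 * Real.pi / F.a) ^ 2 ≤ 0 := by
    push_cast at h
    rw [one_mul] at h
    linarith
  have hm' : k.1 * Real.pi / F.a = 0 :=
    pow_eq_zero_iff two_ne_zero |>.1 (le_antisymm hm (sq_nonneg _))
  have hk1 : k.1 = 0 := by
    rw [div_eq_zero_iff, mul_eq_zero] at hm'
    have : (k.1 : ℝ) = 0 := (hm'.resolve_right ha.ne').resolve_right hpi.ne'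
    exact_mod_cast this
  exact hk (height_injective hk1 (hheight.trans height_zero_one.symm))

/-- The pointwise Weyl counting function at the lowest frequency of a wave that depends on the
vertical coordinate. -/
theorem exists_weylCount_chart (B : M.Eigenbasis) : ∃ C : ℝ, 0 ≤ C ∧ ∀ z,
    weylCount B (F.chart z) (2 * Real.pi / F.b) = ENNReal.ofReal
      (C + 2 / (F.a * F.b) * Real.cos (2 * Real.pi * z.2 / F.b) ^ 2) := by
  set S := (F.finite_waveFreq_le (2 * Real.pi / F.b)).toFinset with hS
  have hmem : ((0, 1) : ℤ × ℕ) ∈ S := by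
    rw [hS, Set.Finite.mem_toFinset, Set.mem_ofPred_eq, height_zero_one, waveFreq_zero_one]
  refine ⟨∑ k ∈ S.erase (0, 1), F.weight k,
    Finset.sum_nonneg fun k _ => (F.weight_pos k).le, fun z => ?_⟩
  rw [weylCount_eq B F, ← hS, ← Finset.sum_erase_add _ _ hmem]
  congr 2
  -- The remaining waves have height `0`, hence even horizontal index and constant modulus; they
  -- make up `C`.
  · refine Finset.sum_congr rfl fun k hk => ?_
    rw [Finset.mem_erase, hS, Set.Finite.mem_toFinset] at hk
    have h0 := F.height_eq_zero_of_waveFreq_le hk.2 hk.1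
    have heven : Even k.1 := by
      by_contra hodd
      exact (height_pos_of_odd (Int.not_even_iff_odd.1 hodd)).ne' h0
    rw [norm_basisWave_chart_sq, parityTrig_even heven, h0]
    simp
  · rw [norm_basisWave_chart_sq, parityTrig_even Even.zero, weight, height_zero_one,
      if_neg one_ne_zero]
    simp

end Frame

end FlatKleinBottle

end
/-- On every flat Klein bottle there is an orthonormal eigenbasis of the Laplacian, and, for the
pointwise Weyl counting function computed from any such basis, `N_x(λ)` is not constant in `x`,
and `N_x = N_y` implies that some isometry of the Klein bottle maps `x` to `y`. -/
theorem theorem2 (M : FlatKleinBottle) :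
    Nonempty M.Eigenbasis ∧
    ∀ B : M.Eigenbasis,
      (∃ (lam : ℝ) (x y : M.Carrier),
        FlatKleinBottle.weylCount B x lam ≠ FlatKleinBottle.weylCount B y lam) ∧
      ∀ x y : M.Carrier,
        (∀ lam : ℝ, FlatKleinBottle.weylCount B x lam = FlatKleinBottle.weylCount B y lam) →
        ∃ F : M.Carrier ≃ᵢ M.Carrier, F x = y := by
  refine ⟨M.nonempty_eigenbasis, fun B => ?_⟩
  let F := M.nonempty_frame.some
  have ha := F.a_pos
  have hb := F.b_pos
  obtain ⟨C, hC, hN⟩ := F.exists_weylCount_chart B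
  have hinj : ∀ z w : ℝ × ℝ, FlatKleinBottle.weylCount B (F.chart z) (2 * Real.pi / F.b) =
      FlatKleinBottle.weylCount B (F.chart w) (2 * Real.pi / F.b) →
      Real.cos (2 * Real.pi * z.2 / F.b) ^ 2 = Real.cos (2 * Real.pi * w.2 / F.b) ^ 2 := by
    intro z w h
    rw [hN, hN, ENNReal.ofReal_eq_ofReal_iff (by positivity) (by positivity)] at h
    have h2 : (2 / (F.a * F.b)) ≠ 0 := by positivity
    exact mul_left_cancel₀ h2 (add_left_cancel h)
  constructor
  -- The squared cosine is `1` at height `0` and `0` at height `b / 4`.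
  · refine ⟨2 * Real.pi / F.b, F.chart (0, 0), F.chart (0, F.b / 4), fun h => ?_⟩
    have h1 := hinj _ _ h
    have h2 : 2 * Real.pi * (F.b / 4) / F.b = Real.pi / 2 := by field_simp; norm_num
    simp only at h1
    rw [h2, Real.cos_pi_div_two] at h1
    norm_num at h1
  · intro x y h
    obtain ⟨z, -, rfl⟩ := F.exists_chart_eq x
    obtain ⟨w, -, rfl⟩ := F.exists_chart_eq y
    have h1 := hinj z w (h _)
    -- Doubling the angle replaces the squared cosine by a cosine, so equality means that the
    -- heights agree up to sign modulo `b / 2`.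
    have h2 : Real.cos (2 * (2 * Real.pi * z.2 / F.b)) =
        Real.cos (2 * (2 * Real.pi * w.2 / F.b)) := by
      rw [Real.cos_two_mul, Real.cos_two_mul, h1]
    have hpi := Real.pi_ne_zero
    obtain ⟨j, hj | hj⟩ := Real.cos_eq_cos_iff.1 h2
    · obtain ⟨Φ, hΦ⟩ := F.exists_isometry_chart (w.1 - z.1) j
      refine ⟨Φ, (hΦ z).trans (congrArg F.chart ?_)⟩
      field_simp at hj
      refine Prod.ext (by simp) ?_
      simp only
      linarith
    · obtain ⟨Φ, hΦ⟩ := F.exists_isometry_chart (w.1 - (z.1 + F.a)) j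
      refine ⟨Φ, ?_⟩
      -- For opposite heights, the glide reflection gives another representative of the same point
      -- with the sign of its height changed; a translation then suffices.
      have hz : F.chart z = F.chart (z.1 + F.a, -z.2) :=
        (F.chart_eq _ _).2 ⟨-1, 0, by simp, by simp⟩
      rw [hz, hΦ]
      congr 1
      field_simp at hj
      refine Prod.ext (by simp) ?_
      simp only
      linarith
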